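/- Let $p=q$ be natural numbers, let $a_1,\dots,a_p,b_1,\dots,b_q$ be real numbers with $$\mu=\sum_{j=1}^q b_j-\sum_{i=1}^p a_i+\frac{p-q}{2}>0,$$ and let $\lambda>0$, $z\in\mathbb R$ and $t\in\mathbb C$ with $|t|<1$. Put $\binom{x}{y}=\frac{\Gamma(x+1)}{\Gamma(y+1)\Gamma(x-y+1)}$, and write $${}_p\Psi_q\Big[{(a_1,A_1),\dots,(a_p,A_p)\atop (b_1,B_1),\dots,(b_q,B_q)}\Big|z\Big]=\sum_{n=0}^\infty\frac{\prod_{i=1}^p\Gamma(a_i+nA_i)}{\prod_{j=1}^q\Gamma(b_j+nB_j)}\frac{z^n}{n!},\qquad \rho=\prod_{i=1}^pA_i^{-A_i}\prod_{j=1}^qB_j^{B_j}$$ (with $1/\Gamma=0$ at the poles of $\Gamma$), ${}_pF_q\big[{a_1,\dots,a_p\atop b_1,\dots,b_q}\big|z\big]=\sum_{n\ge0}\frac{\prod_i (a_i)_n}{\prod_j (b_j)_n}\frac{z^n}{n!}$ with $(x)_n=x(x+1)\cdots(x+n-1)$, and $\mathcal L_Tf(s)=\int_0^Te^{-\xi s}f(\xi)\,d\xi$.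 For $0<x<1$ let $$G^{p,0}_{q,p}\Big(x\Big|{b_1,\dots,b_q\atop a_1,\dots,a_p}\Big)=\frac1{2\pi i}\int_{L}\frac{\prod_{i=1}^p\Gamma(a_i+s)}{\prod_{j=1}^q\Gamma(b_j+s)}\,x^{-s}\,ds$$ be the Meijer $G$-function, where $L$ is a left loop around all poles of the integrand: it runs from $-\infty+i\alpha$ to $c+i\alpha$, to $c+i\beta$, to $-\infty+i\beta$ along straight lines, with any $\alpha<0<\beta$ and any $c>\max_i(-a_i)$. Powers $(1-t\xi)^{-\lambda}$ are principal values. (i) Let $A>0$, take $A_i=B_j=A$ for all $i,j$ (so that $\rho=1$), and suppose that $\min_i (a_i/A)\ge1$. Then $$\sum_{k=0}^\infty\binom{\lambda+k-1}{k}\,{}_p\Psi_q\Big[{(a_1+kA,A),\dots,(a_p+kA,A)\atop (b_1+kA,A),\dots,(b_q+kA,A)}\Big|z\Big]t^k=\frac1A\,\mathcal L_\rho\Big(\xi^{-1}(1-t\xi)^{-\lambda}G^{p,0}_{q,p}\Big(\xi^{1/A}\Big|{b_1,\dots,b_q\atop a_1,\dots,a_p}\Big)\Big)(-z).$$ (ii)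 Suppose that $\min_i a_i\ge1$ and that no $b_j$ is an integer $\le0$, and take $A_i=B_j=1$ (so that $\rho=1$). Then $$\sum_{k=0}^\infty\binom{\lambda+k-1}{k}\frac{\prod_{i=1}^p\Gamma(a_i+k)}{\prod_{j=1}^q\Gamma(b_j+k)}\;{}_pF_q\Big[{a_1+k,\dots,a_p+k\atop b_1+k,\dots,b_q+k}\Big|z\Big]t^k=\mathcal L_\rho\Big(\xi^{-1}(1-t\xi)^{-\lambda}G^{p,0}_{q,p}\Big(\xi\Big|{b_1,\dots,b_q\atop a_1,\dots,a_p}\Big)\Big)(-z).$$ In both cases the series that define ${}_p\Psi_q$ and ${}_pF_q$, the contour integrals that define $G^{p,0}_{q,p}$ for arguments in $(0,1)$, the integral over $\xi$ and the series over $k$ all converge absolutely. -/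

import Mathlib

noncomputable section

namespace FoxWright

/-- The generalized binomial coefficient `Γ(x+1) / (Γ(y+1) Γ(x-y+1))`. -/
def gbinom (x y : ℝ) : ℝ :=
  Real.Gamma (x + 1) / (Real.Gamma (y + 1) * Real.Gamma (x - y + 1))

/-- The `n`-th term of the Fox-Wright series with parameters `(a, A); (b, B)`.
Mathlib's `Γ` vanishes at its poles and `x / 0 = 0`, so that `1 / Γ` is zero at the poles of `Γ`,
which is the usual convention for the lower parameters. -/
def foxWrightTerm {p q : ℕ} (a A : Fin p → ℝ) (b B : Fin q → ℝ) (z : ℂ) (n : ℕ) : ℂ :=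
  (((∏ i, Real.Gamma (a i + n * A i)) / (∏ j, Real.Gamma (b j + n * B j)) : ℝ) : ℂ)
    * (z ^ n / (n.factorial : ℂ))

/-- The Fox-Wright function `pΨq[(a, A); (b, B) | z]`. -/
def foxWright {p q : ℕ} (a A : Fin p → ℝ) (b B : Fin q → ℝ) (z : ℂ) : ℂ :=
  ∑' n : ℕ, foxWrightTerm a A b B z n

/-- `ρ = ∏ A_i ^ (-A_i) · ∏ B_j ^ B_j`. -/
def rho {p q : ℕ} (A : Fin p → ℝ) (B : Fin q → ℝ) : ℝ :=
  (∏ i, A i ^ (-A i)) * ∏ j, B j ^ B j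

/-- `μ = ∑ b_j - ∑ a_i + (p - q) / 2`. -/
def mu {p q : ℕ} (a : Fin p → ℝ) (b : Fin q → ℝ) : ℝ :=
  ∑ j, b j - ∑ i, a i + ((p : ℝ) - (q : ℝ)) / 2

/-- The `n`-th term of the generalized hypergeometric series; `(ascPochhammer ℝ n).eval x` is
the shifted factorial `x (x+1) ⋯ (x+n-1)`. -/
def hypergeometricTerm {p q : ℕ} (a : Fin p → ℝ) (b : Fin q → ℝ) (z : ℂ) (n : ℕ) : ℂ :=
  (((∏ i, (ascPochhammer ℝ n).eval (a i)) / (∏ j, (ascPochhammer ℝ n).eval (b j)) : ℝ) : ℂ)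
    * (z ^ n / (n.factorial : ℂ))

/-- The generalized hypergeometric function `pFq[a; b | z]`. -/
def hypergeometric {p q : ℕ} (a : Fin p → ℝ) (b : Fin q → ℝ) (z : ℂ) : ℂ :=
  ∑' n : ℕ, hypergeometricTerm a b z n

/-- A left loop for the parameters `a`: it comes from `-∞ + iα` along the line `Im s = α`, goes up
along `Re s = c` to the line `Im s = β`, and returns to `-∞ + iβ`. The poles `-a_i - n` of the
functions `Γ(a_i + s)` all lie inside it. -/
structure LeftLoop {p : ℕ} (a : Fin p → ℝ) where
  c : ℝ
  α : ℝ
  β : ℝ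
  α_neg : α < 0
  β_pos : 0 < β
  poles_left : ∀ i, -a i < c

/-- The contour integral of `f` along a left loop. -/
def LeftLoop.integral {p : ℕ} {a : Fin p → ℝ} (L : LeftLoop a) (f : ℂ → ℂ) : ℂ :=
  (∫ x in Set.Iic L.c, f ((x : ℂ) + (L.α : ℂ) * Complex.I))
    + Complex.I * (∫ y in L.α..L.β, f ((L.c : ℂ) + (y : ℂ) * Complex.I))
    - ∫ x in Set.Iic L.c, f ((x : ℂ) + (L.β : ℂ) * Complex.I)

/-- Absolute convergence of the contour integral of `f` along a left loop. -/
def LeftLoop.Converges {p : ℕ} {a : Fin p → ℝ} (L : LeftLoop a) (f : ℂ → ℂ) : Prop :=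
  MeasureTheory.IntegrableOn (fun x : ℝ => f ((x : ℂ) + (L.α : ℂ) * Complex.I)) (Set.Iic L.c)
    ∧ IntervalIntegrable (fun y : ℝ => f ((L.c : ℂ) + (y : ℂ) * Complex.I))
        MeasureTheory.volume L.α L.β
    ∧ MeasureTheory.IntegrableOn
        (fun x : ℝ => f ((x : ℂ) + (L.β : ℂ) * Complex.I)) (Set.Iic L.c)

/-- The Mellin-Barnes integrand `∏ Γ(a_i + s) / ∏ Γ(b_j + s) · x ^ (-s)`. -/
def meijerGIntegrand {p q : ℕ} (a : Fin p → ℝ) (b : Fin q → ℝ) (x : ℝ) (s : ℂ) : ℂ :=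
  (∏ i, Complex.Gamma ((a i : ℂ) + s)) / (∏ j, Complex.Gamma ((b j : ℂ) + s)) * (x : ℂ) ^ (-s)

/-- The Meijer function `G^{p,0}_{q,p}(x | b; a)` with upper parameters `b` and lower
parameters `a`, as a Mellin-Barnes integral along the left loop `L`. -/
def meijerG {p q : ℕ} {a : Fin p → ℝ} (L : LeftLoop a) (b : Fin q → ℝ) (x : ℝ) : ℂ :=
  1 / (2 * (Real.pi : ℂ) * Complex.I) * L.integral (meijerGIntegrand a b x)

/-- The finite Laplace transform `∫_0^T e^{-ξ s} f(ξ) dξ`. -/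
def finiteLaplace (T : ℝ) (f : ℝ → ℂ) (s : ℝ) : ℂ :=
  ∫ ξ in (0 : ℝ)..T, (Real.exp (-ξ * s) : ℂ) * f ξ

end FoxWright

end

/-!
# A generating function for Fox-Wright functions with equal weights

Write `M(s) = ∏ Γ(a_i + s) / ∏ Γ(b_j + s)` (`gammaRatio`) and `G` for Meijer's function. All the
claims follow from the moment formula

  `∫ ξ in (0, 1), ξ ^ k * ξ⁻¹ * G(ξ ^ (1 / A)) = A * M(k A)`,

where the integral converges absolutely (`integrableOn_and_moments`). Indeed the coefficients of
the Fox-Wright series are the values `M((k + n) A)`; summation over `n` under the integral sign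
gives the factor `exp (z ξ)`, and summation over `k` gives the binomial series
`(1 - t ξ) ^ (-λ)`.

The moment formula is obtained by integrating under the loop integral that defines `G`: the power
`ξ ^ (s - 1 - κ w)` has integral `1 / (s - κ w)` over `(0, 1)`, so that the Mellin transform of `G`
is a Cauchy transform of `M` along the loop (`LeftLoop.mellin_meijerG`). Pushing the loop to
infinity, away from the half-strip that contains the poles, only the residue at `w = s / κ` remains
(`tendsto_truncated_loop_integral`).

Both the use of Fubini's theorem and the passage to infinity rest on the estimate
`‖M(w)‖ ≤ C ‖w‖ ^ (-μ)` with `μ > 0`, uniformly away from the poles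
(`exists_norm_gammaRatio_le`). It needs no asymptotic expansion of the Gamma function: by the
functional equation, the logarithms of `‖M(w)‖ ‖w‖ ^ μ` at `w` and at `w + 1` differ by
`O(1 / ‖w‖²)`, since the terms of first order cancel by the choice of `μ`. The sum of these errors
along `w, w + 1, w + 2, …` is bounded uniformly in `w`, and `‖M(w + n)‖ ‖w + n‖ ^ μ` tends to `1`
by Euler's limit formula.
-/

namespace FoxWright

open Complex Filter Topology Set
open scoped Interval

/-! ### Decay of quotients of Gamma functions -/

section GammaRatio

/-- The quotient `∏ Γ(a_i + s) / ∏ Γ(b_j + s)`, whose inverse Mellin transform is Meijer's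
function. At a zero of a factor `1 / Γ(b_j + s)` the convention `Γ = 0` gives the right
value `0`. -/
noncomputable def gammaRatio {p q : ℕ} (a : Fin p → ℝ) (b : Fin q → ℝ) (s : ℂ) : ℂ :=
  (∏ i, Complex.Gamma ((a i : ℂ) + s)) / ∏ j, Complex.Gamma ((b j : ℂ) + s)

lemma one_div_one_add_sq_le_arctan_sub (y : ℝ) :
    1 / (1 + y ^ 2) ≤ 3 * (Real.arctan (y + 1) - Real.arctan y) := by
  obtain ⟨t, ht, h⟩ := exists_hasDerivAt_eq_slope Real.arctan (fun t => 1 / (1 + t ^ 2))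
    (show y < y + 1 by linarith) Real.continuous_arctan.continuousOn
    (fun t _ => by simpa using Real.hasDerivAt_arctan t)
  rw [add_sub_cancel_left, div_one] at h
  rw [← h, mul_one_div, div_le_div_iff₀ (by positivity) (by positivity)]
  nlinarith [ht.1, ht.2, sq_nonneg (y - 1), sq_nonneg y, sq_nonneg (t - 2 * y)]

/-- The bound is uniform in `x`, because the sum is dominated by a telescoping sum of values of
`arctan`. -/
lemma sum_one_div_one_add_sq_le (x : ℝ) (n : ℕ) :
    ∑ k ∈ Finset.range n, 1 / (1 + (x + k) ^ 2) ≤ 3 * Real.pi := by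
  calc ∑ k ∈ Finset.range n, 1 / (1 + (x + k) ^ 2)
      ≤ ∑ k ∈ Finset.range n, 3 * (Real.arctan (x + (k + 1 : ℕ)) - Real.arctan (x + k)) := by
        refine Finset.sum_le_sum fun k _ => ?_
        have := one_div_one_add_sq_le_arctan_sub (x + k)
        rwa [add_assoc, ← Nat.cast_succ] at this
    _ = 3 * (Real.arctan (x + n) - Real.arctan x) := by
        rw [← Finset.mul_sum, Finset.sum_range_sub (fun k : ℕ => Real.arctan (x + k))]
        simp
    _ ≤ 3 * Real.pi := by
        have h1 := Real.arctan_lt_pi_div_two (x + n)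
        have h2 := Real.neg_pi_div_two_lt_arctan x
        linarith

lemma norm_one_add_le_exp (u : ℂ) : ‖1 + u‖ ≤ Real.exp (u.re + ‖u‖ ^ 2) := by
  refine le_of_sq_le_sq ?_ (Real.exp_pos _).le
  rw [← Real.exp_nat_mul, Complex.sq_norm, Complex.normSq_apply]
  refine le_trans ?_ (Real.add_one_le_exp _)
  rw [Complex.sq_norm, Complex.normSq_apply]
  simp only [add_re, one_re, add_im, one_im, Nat.cast_ofNat]
  nlinarith [sq_nonneg u.re, sq_nonneg u.im]

lemma exp_le_norm_one_add {u : ℂ} (hu : ‖u‖ ≤ 1 / 2) :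
    Real.exp (u.re - ‖u‖ ^ 2) ≤ ‖1 + u‖ := by
  have h0 : 1 + u ≠ 0 := by
    intro h
    have : u = -1 := by linear_combination h
    rw [this] at hu
    norm_num at hu
  rw [← Real.exp_log (norm_pos_iff.mpr h0), Real.exp_le_exp, ← Complex.log_re]
  have h1 := Complex.norm_log_one_add_sub_self_le (z := u) (by linarith)
  have h2 : (1 - ‖u‖)⁻¹ ≤ 2 := by
    rw [inv_le_comm₀ (by linarith) (by norm_num)]
    linarith
  have h3 := Complex.abs_re_le_norm (Complex.log (1 + u) - u)
  rw [sub_re] at h3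
  have h4 := (abs_le.mp (h3.trans h1)).1
  nlinarith [sq_nonneg ‖u‖]

variable {p : ℕ} (a b : Fin p → ℝ)

lemma gammaRatio_eq_mul {s : ℂ} (h : ∀ i, (a i : ℂ) + s ≠ 0) :
    gammaRatio a b s
      = (∏ i, ((b i : ℂ) + s) / ((a i : ℂ) + s)) * gammaRatio a b (s + 1) := by
  simp only [gammaRatio]
  rw [← Finset.prod_div_distrib, ← Finset.prod_div_distrib, ← Finset.prod_mul_distrib]
  refine Finset.prod_congr rfl fun i _ => ?_
  have h1 := Complex.one_div_Gamma_eq_self_mul_one_div_Gamma_add_one ((b i : ℂ) + s)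
  have h2 := Complex.Gamma_add_one _ (h i)
  rw [← add_assoc, ← add_assoc, h2, div_eq_mul_inv, h1]
  field_simp [h i]

/-- A number that is at least `1` and at least the absolute value of every parameter. -/
noncomputable def paramBound {p : ℕ} (a b : Fin p → ℝ) : ℝ := 1 + ∑ i, |a i| + ∑ i, |b i|

lemma one_le_paramBound : 1 ≤ paramBound a b := by
  have h1 : 0 ≤ ∑ i, |a i| := Finset.sum_nonneg fun _ _ => abs_nonneg _
  have h2 : 0 ≤ ∑ i, |b i| := Finset.sum_nonneg fun _ _ => abs_nonneg _
  unfold paramBound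
  linarith

lemma abs_le_paramBound_left (i : Fin p) : |a i| ≤ paramBound a b := by
  have h1 := Finset.single_le_sum (f := fun i => |a i|) (fun _ _ => abs_nonneg _)
    (Finset.mem_univ i)
  have h2 : 0 ≤ ∑ i, |b i| := Finset.sum_nonneg fun _ _ => abs_nonneg _
  unfold paramBound
  linarith

lemma abs_le_paramBound_right (i : Fin p) : |b i| ≤ paramBound a b := by
  have h1 := Finset.single_le_sum (f := fun i => |b i|) (fun _ _ => abs_nonneg _)
    (Finset.mem_univ i)
  have h2 : 0 ≤ ∑ i, |a i| := Finset.sum_nonneg fun _ _ => abs_nonneg _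
  unfold paramBound
  linarith

/-- The region where the quotient of Gamma functions is controlled: it avoids the poles of all
the factors, and it is stable under `s ↦ s + 1`. -/
def tameRegion {p : ℕ} (a b : Fin p → ℝ) (δ : ℝ) : Set ℂ :=
  {s | δ ≤ |s.im| ∨ 2 * paramBound a b ≤ s.re}

variable {a b} {δ : ℝ}

lemma add_natCast_mem_tameRegion {s : ℂ} (hs : s ∈ tameRegion a b δ) (n : ℕ) :
    s + n ∈ tameRegion a b δ := by
  rcases hs with h | h
  · left; simpa using h
  · right
    have : (0 : ℝ) ≤ n := n.cast_nonneg
    simp only [add_re, natCast_re]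
    linarith

lemma real_add_ne_neg_natCast (hδ : 0 < δ) {s : ℂ} (hs : s ∈ tameRegion a b δ) {x : ℝ}
    (hx : |x| ≤ paramBound a b) (n : ℕ) : (x : ℂ) + s ≠ -n := by
  intro h
  have h1 := congrArg re h
  have h2 := congrArg im h
  simp only [add_re, add_im, ofReal_re, ofReal_im, neg_re, neg_im, natCast_re, natCast_im] at h1 h2
  have h3 := one_le_paramBound a b
  have h4 : (0 : ℝ) ≤ n := n.cast_nonneg
  rcases hs with h | h
  · rw [show s.im = 0 by linarith, abs_zero] at h
    linarith
  · have := (abs_le.mp hx).1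
    linarith

/-- Far from the origin the quotient of consecutive values of `s ↦ ‖gammaRatio a b s‖ * ‖s‖ ^ m`
is at most `1 + O(‖s‖⁻²)`: the terms of first order cancel by the choice of `m`. -/
lemma prod_norm_le_of_large {m : ℝ} (hm : m = ∑ i, b i - ∑ i, a i) (hm0 : 0 ≤ m) {s : ℂ}
    (hs : 2 * paramBound a b ≤ ‖s‖) :
    (∏ i, ‖(b i : ℂ) + s‖ / ‖(a i : ℂ) + s‖) * (‖s‖ / ‖s + 1‖) ^ m
      ≤ Real.exp ((∑ i, b i ^ 2 + ∑ i, a i ^ 2 + m) / ‖s‖ ^ 2) := by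
  have hB := one_le_paramBound a b
  have hs0 : 0 < ‖s‖ := by linarith
  have hsne : s ≠ 0 := norm_pos_iff.mp hs0
  have hnorm (x : ℝ) : ‖(x : ℂ) / s‖ = |x| / ‖s‖ := by simp
  have hre (x : ℝ) : ((x : ℂ) / s).re = x * (s⁻¹).re := by
    rw [div_eq_mul_inv, re_ofReal_mul]
  have hfac (x : ℝ) : ‖(x : ℂ) + s‖ = ‖s‖ * ‖1 + (x : ℂ) / s‖ := by
    rw [← norm_mul]
    congr 1
    field_simp
    ring
  have hsq (x : ℝ) : ‖(x : ℂ) / s‖ ^ 2 = x ^ 2 / ‖s‖ ^ 2 := by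
    rw [hnorm, div_pow, sq_abs]
  have hup (x : ℝ) : ‖1 + (x : ℂ) / s‖ ≤ Real.exp (x * (s⁻¹).re + x ^ 2 / ‖s‖ ^ 2) := by
    have := norm_one_add_le_exp ((x : ℂ) / s)
    rwa [hre, hsq] at this
  have hlow (x : ℝ) (hx : |x| ≤ paramBound a b) :
      Real.exp (x * (s⁻¹).re - x ^ 2 / ‖s‖ ^ 2) ≤ ‖1 + (x : ℂ) / s‖ := by
    have := exp_le_norm_one_add (u := (x : ℂ) / s) (by
      rw [hnorm, div_le_iff₀ hs0]; linarith)
    rwa [hre, hsq] at this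
  have h1 : ∀ i, ‖(b i : ℂ) + s‖ / ‖(a i : ℂ) + s‖
      ≤ Real.exp ((b i - a i) * (s⁻¹).re + (b i ^ 2 + a i ^ 2) / ‖s‖ ^ 2) := fun i => by
    have hl := hlow (a i) (abs_le_paramBound_left a b i)
    rw [hfac, hfac, mul_div_mul_left _ _ hs0.ne']
    calc ‖1 + (b i : ℂ) / s‖ / ‖1 + (a i : ℂ) / s‖
        ≤ Real.exp (b i * (s⁻¹).re + b i ^ 2 / ‖s‖ ^ 2)
            / Real.exp (a i * (s⁻¹).re - a i ^ 2 / ‖s‖ ^ 2) :=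
          div_le_div₀ (Real.exp_pos _).le (hup _) (Real.exp_pos _) hl
      _ = _ := by rw [← Real.exp_sub]; congr 1; ring
  have h2 : ‖s‖ / ‖s + 1‖ ≤ Real.exp (-(s⁻¹).re + 1 / ‖s‖ ^ 2) := by
    have hl := hlow 1 (by simpa using hB)
    have hf := hfac 1
    rw [add_comm, ofReal_one] at hf
    rw [ofReal_one] at hl
    rw [hf, ← div_div, div_self hs0.ne']
    calc 1 / ‖1 + 1 / s‖ ≤ 1 / Real.exp (1 * (s⁻¹).re - 1 ^ 2 / ‖s‖ ^ 2) :=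
          div_le_div₀ zero_le_one le_rfl (Real.exp_pos _) hl
      _ = _ := by rw [one_div, ← Real.exp_neg]; congr 1; ring
  have h3 : (‖s‖ / ‖s + 1‖) ^ m ≤ Real.exp (m * (-(s⁻¹).re + 1 / ‖s‖ ^ 2)) := by
    rw [mul_comm, Real.exp_mul]
    exact Real.rpow_le_rpow (by positivity) h2 hm0
  calc _ ≤ (∏ i, Real.exp ((b i - a i) * (s⁻¹).re + (b i ^ 2 + a i ^ 2) / ‖s‖ ^ 2))
        * Real.exp (m * (-(s⁻¹).re + 1 / ‖s‖ ^ 2)) :=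
        mul_le_mul (Finset.prod_le_prod (fun _ _ => by positivity) fun i _ => h1 i) h3
          (by positivity) (Finset.prod_nonneg fun _ _ => (Real.exp_pos _).le)
    _ = _ := by
        rw [← Real.exp_sum, ← Real.exp_add]
        congr 1
        rw [Finset.sum_add_distrib, ← Finset.sum_mul, ← Finset.sum_div, Finset.sum_add_distrib,
          Finset.sum_sub_distrib, ← hm]
        ring

/-- Near the origin only the distance to the real axis matters. -/
lemma prod_norm_le_of_small (hδ : 0 < δ) {m : ℝ} (hm0 : 0 ≤ m) {s : ℂ} (him : δ ≤ |s.im|)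
    (hs : ‖s‖ ≤ 2 * paramBound a b) :
    (∏ i, ‖(b i : ℂ) + s‖ / ‖(a i : ℂ) + s‖) * (‖s‖ / ‖s + 1‖) ^ m
      ≤ (3 * paramBound a b / δ) ^ p * (2 * paramBound a b / δ) ^ m := by
  have hB := one_le_paramBound a b
  have hlow (x : ℝ) : δ ≤ ‖(x : ℂ) + s‖ :=
    him.trans (by simpa using Complex.abs_im_le_norm ((x : ℂ) + s))
  refine mul_le_mul ?_ ?_ (by positivity) (by positivity)
  · calc _ ≤ ∏ _i : Fin p, 3 * paramBound a b / δ := by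
          refine Finset.prod_le_prod (fun _ _ => by positivity) fun i _ => ?_
          refine div_le_div₀ (by positivity) ?_ hδ (hlow _)
          have := norm_add_le (b i : ℂ) s
          rw [Complex.norm_real, Real.norm_eq_abs] at this
          have := abs_le_paramBound_right a b i
          linarith
      _ = _ := by rw [Finset.prod_const, Finset.card_univ, Fintype.card_fin]
  · refine Real.rpow_le_rpow (by positivity) ?_ hm0
    refine div_le_div₀ (by positivity) hs hδ ?_
    rw [add_comm]
    exact_mod_cast hlow 1

variable (a b)

/-- One step of the recursion `s ↦ s + 1` changes `‖gammaRatio a b s‖ * ‖s‖ ^ m` by a factor whose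
logarithm is at most `K / (1 + (Re s)²)`, also for small `s`. -/
lemma exists_step_bound (hδ : 0 < δ) {m : ℝ} (hm : m = ∑ i, b i - ∑ i, a i) (hm0 : 0 ≤ m) :
    ∃ K, 0 ≤ K ∧ ∀ s ∈ tameRegion a b δ, ‖gammaRatio a b s‖ * ‖s‖ ^ m
      ≤ Real.exp (K / (1 + s.re ^ 2)) * (‖gammaRatio a b (s + 1)‖ * ‖s + 1‖ ^ m) := by
  have hB := one_le_paramBound a b
  set K₁ := ∑ i, b i ^ 2 + ∑ i, a i ^ 2 + m with hK₁
  set K₂ := (3 * paramBound a b / δ) ^ p * (2 * paramBound a b / δ) ^ m with hK₂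
  have hK₁0 : 0 ≤ K₁ := add_nonneg (add_nonneg (Finset.sum_nonneg fun _ _ => sq_nonneg _)
    (Finset.sum_nonneg fun _ _ => sq_nonneg _)) hm0
  have hK₂0 : 0 ≤ K₂ := by positivity
  refine ⟨2 * K₁ + K₂ * (1 + (2 * paramBound a b) ^ 2), by positivity, fun s hs => ?_⟩
  have key : (∏ i, ‖(b i : ℂ) + s‖ / ‖(a i : ℂ) + s‖) * (‖s‖ / ‖s + 1‖) ^ m
      ≤ Real.exp ((2 * K₁ + K₂ * (1 + (2 * paramBound a b) ^ 2)) / (1 + s.re ^ 2)) := by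
    -- the summand `2 K₁` of the constant serves large `s`, the other one small `s`
    rcases le_or_gt (2 * paramBound a b) ‖s‖ with h | h
    · refine (prod_norm_le_of_large hm hm0 h).trans (Real.exp_le_exp.mpr ?_)
      have h1 : s.re ^ 2 ≤ ‖s‖ ^ 2 := by
        rw [← sq_abs s.re]
        gcongr
        exact Complex.abs_re_le_norm s
      rw [div_le_div_iff₀ (by nlinarith) (by positivity)]
      have h2 : 1 + s.re ^ 2 ≤ 2 * ‖s‖ ^ 2 := by nlinarith
      calc K₁ * (1 + s.re ^ 2) ≤ K₁ * (2 * ‖s‖ ^ 2) := by gcongr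
        _ ≤ _ := by nlinarith [mul_nonneg (mul_nonneg hK₂0
            (show 0 ≤ 1 + (2 * paramBound a b) ^ 2 by positivity)) (sq_nonneg ‖s‖)]
    · have him : δ ≤ |s.im| := by
        rcases hs with h' | h'
        · exact h'
        · exact absurd (h'.trans ((le_abs_self _).trans (Complex.abs_re_le_norm s))) (not_le.mpr h)
      refine (prod_norm_le_of_small hδ hm0 him h.le).trans ?_
      refine le_trans ?_ ((le_add_of_nonneg_right zero_le_one).trans (Real.add_one_le_exp _))
      rw [le_div_iff₀ (by positivity)]
      have h1 : s.re ^ 2 ≤ (2 * paramBound a b) ^ 2 := by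
        rw [← sq_abs s.re]
        gcongr
        exact (Complex.abs_re_le_norm s).trans h.le
      nlinarith
  have hne1 : s + 1 ≠ 0 := by
    have := real_add_ne_neg_natCast (a := a) (b := b) hδ (add_natCast_mem_tameRegion hs 1)
      (x := 0) (by simpa using zero_le_one.trans hB) 0
    simpa using this
  have h1 : 0 < ‖s + 1‖ := norm_pos_iff.mpr hne1
  rw [gammaRatio_eq_mul a b (fun i => by
    simpa using real_add_ne_neg_natCast hδ hs (abs_le_paramBound_left a b i) 0), norm_mul,
    norm_prod]
  simp only [norm_div]
  calc _ = (∏ i, ‖(b i : ℂ) + s‖ / ‖(a i : ℂ) + s‖) * (‖s‖ / ‖s + 1‖) ^ m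
        * (‖gammaRatio a b (s + 1)‖ * ‖s + 1‖ ^ m) := by
        rw [Real.div_rpow (norm_nonneg _) (norm_nonneg _)]
        have := (Real.rpow_pos_of_pos h1 m).ne'
        field_simp
    _ ≤ _ := by gcongr

lemma iterate_step_bound {K : ℝ} {m : ℝ}
    (h : ∀ s ∈ tameRegion a b δ, ‖gammaRatio a b s‖ * ‖s‖ ^ m
      ≤ Real.exp (K / (1 + s.re ^ 2)) * (‖gammaRatio a b (s + 1)‖ * ‖s + 1‖ ^ m))
    {s : ℂ} (hs : s ∈ tameRegion a b δ) (n : ℕ) :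
    ‖gammaRatio a b s‖ * ‖s‖ ^ m
      ≤ Real.exp (K * ∑ k ∈ Finset.range n, 1 / (1 + (s.re + k) ^ 2))
        * (‖gammaRatio a b (s + n)‖ * ‖s + n‖ ^ m) := by
  induction n with
  | zero => simp
  | succ n ih =>
    refine ih.trans ?_
    rw [Finset.sum_range_succ, mul_add, Real.exp_add, mul_assoc]
    refine mul_le_mul_of_nonneg_left ?_ (Real.exp_pos _).le
    have := h _ (add_natCast_mem_tameRegion hs n)
    rw [mul_one_div, Nat.cast_succ, ← add_assoc]
    simpa only [add_re, natCast_re] using this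

/-- Euler's limit formula for `Γ(z)`, after multiplication by `z (z + 1) ⋯ (z + n)`. -/
lemma tendsto_Gamma_add_div {z : ℂ} (hz : ∀ n : ℕ, z ≠ -n) :
    Tendsto (fun n : ℕ => Gamma (z + (n + 1 : ℕ)) / ((n : ℂ) ^ z * n.factorial)) atTop (𝓝 1) := by
  have hG := Complex.Gamma_ne_zero hz
  have h1 : ∀ n : ℕ, Gamma (z + n) = (∏ j ∈ Finset.range n, (z + j)) * Gamma z := by
    intro n
    induction n with
    | zero => simp
    | succ n ih =>
      rw [Nat.cast_succ, ← add_assoc, Complex.Gamma_add_one _ (fun h => hz n (by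
        linear_combination h)), ih, Finset.prod_range_succ]
      ring
  have h2 := (Complex.GammaSeq_tendsto_Gamma z).inv₀ hG |>.mul_const (Gamma z)
  rw [inv_mul_cancel₀ hG] at h2
  refine h2.congr fun n => ?_
  rw [h1, Complex.GammaSeq, inv_div]
  ring

/-- The factors `n ^ z * n!` of Euler's limit formula combine to `n ^ (-m)`, because there are as
many Gamma functions in the numerator as in the denominator. -/
lemma tendsto_norm_gammaRatio_mul {m : ℝ} (hm : m = ∑ i, b i - ∑ i, a i) (hδ : 0 < δ) {s : ℂ}
    (hs : s ∈ tameRegion a b δ) :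
    Tendsto (fun n : ℕ => ‖gammaRatio a b (s + n)‖ * ‖s + n‖ ^ m) atTop (𝓝 1) := by
  rw [← tendsto_add_atTop_iff_nat 1]
  have hA := tendsto_finsetProd (s := Finset.univ) (f := fun i (n : ℕ) =>
    ‖Gamma ((a i : ℂ) + s + (n + 1 : ℕ)) / ((n : ℂ) ^ ((a i : ℂ) + s) * n.factorial)‖)
    (a := fun _ => (1 : ℝ)) (fun i _ => by
      simpa using (tendsto_Gamma_add_div
        (real_add_ne_neg_natCast hδ hs (abs_le_paramBound_left a b i))).norm)
  have hBt := tendsto_finsetProd (s := Finset.univ) (f := fun i (n : ℕ) =>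
    ‖Gamma ((b i : ℂ) + s + (n + 1 : ℕ)) / ((n : ℂ) ^ ((b i : ℂ) + s) * n.factorial)‖)
    (a := fun _ => (1 : ℝ)) (fun i _ => by
      simpa using (tendsto_Gamma_add_div
        (real_add_ne_neg_natCast hδ hs (abs_le_paramBound_right a b i))).norm)
  have hq : Tendsto (fun n : ℕ => ‖s + (n + 1 : ℕ)‖ / n) atTop (𝓝 1) := by
    have h0 : Tendsto (fun n : ℕ => (n : ℂ)⁻¹) atTop (𝓝 0) :=
      tendsto_inv_atTop_nhds_zero_nat (𝕜 := ℂ)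
    have h1 : Tendsto (fun n : ℕ => ‖(s + 1) * (n : ℂ)⁻¹ + 1‖) atTop (𝓝 1) := by
      simpa using (((h0.const_mul (s + 1)).add_const 1).norm)
    refine h1.congr' ?_
    filter_upwards [eventually_gt_atTop 0] with n hn
    have hn' : (n : ℂ) ≠ 0 := by exact_mod_cast hn.ne'
    rw [show s + (n + 1 : ℕ) = ((s + 1) * (n : ℂ)⁻¹ + 1) * n by
      push_cast; field_simp; ring, norm_mul, Complex.norm_natCast, mul_div_cancel_right₀]
    exact_mod_cast hn.ne'
  have hqm := hq.rpow_const (p := m) (Or.inl one_ne_zero)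
  have := (hA.div hBt (by simp)).mul hqm
  simp only [Finset.prod_const_one, div_one, Real.one_rpow, mul_one] at this
  refine this.congr' ?_
  filter_upwards [eventually_gt_atTop 0] with n hn
  have hn' : (0 : ℝ) < n := by exact_mod_cast hn
  have hcp (x : ℝ) : ‖(n : ℂ) ^ ((x : ℂ) + s)‖ = (n : ℝ) ^ (x + s.re) := by
    rw [Complex.norm_natCast_cpow_of_pos hn]
    simp
  simp only [Pi.div_apply, gammaRatio, norm_div, norm_mul, norm_prod, hcp, Complex.norm_natCast,
    Finset.prod_div_distrib, Finset.prod_mul_distrib, Finset.prod_const, add_assoc]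
  rw [Real.div_rpow (norm_nonneg _) hn'.le]
  have hprod : ∏ i, (n : ℝ) ^ (b i + s.re) = (∏ i, (n : ℝ) ^ (a i + s.re)) * (n : ℝ) ^ m := by
    rw [← Real.rpow_sum_of_pos hn', ← Real.rpow_sum_of_pos hn', ← Real.rpow_add hn', hm,
      Finset.sum_add_distrib, Finset.sum_add_distrib]
    congr 1
    ring
  rw [hprod]
  have h1 : (∏ i, (n : ℝ) ^ (a i + s.re)) ≠ 0 :=
    Finset.prod_ne_zero_iff.mpr fun i _ => (Real.rpow_pos_of_pos hn' _).ne'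
  have h2 := (Real.rpow_pos_of_pos hn' m).ne'
  have h3 : (n.factorial : ℝ) ≠ 0 := by positivity
  -- a vanishing denominator is harmless: both sides are `0` by `x / 0 = 0`
  by_cases h4 : ∏ i, ‖Gamma ((b i : ℂ) + (s + (n + 1 : ℕ)))‖ = 0
  · rw [h4]
    simp only [zero_div, div_zero, zero_mul]
  field_simp

/-- The quotient of Gamma functions decays like `‖s‖ ^ (-m)`, uniformly on its tame region. -/
theorem exists_norm_gammaRatio_le (hδ : 0 < δ) {m : ℝ} (hm : m = ∑ i, b i - ∑ i, a i)
    (hm0 : 0 ≤ m) :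
    ∃ C, 0 < C ∧ ∀ s ∈ tameRegion a b δ, ‖gammaRatio a b s‖ ≤ C * ‖s‖ ^ (-m) := by
  obtain ⟨K, hK, h⟩ := exists_step_bound a b hδ hm hm0
  refine ⟨Real.exp (K * (3 * Real.pi)), Real.exp_pos _, fun s hs => ?_⟩
  have hne : s ≠ 0 := by
    have := real_add_ne_neg_natCast hδ hs (x := 0)
      (by simpa using zero_le_one.trans (one_le_paramBound a b)) 0
    simpa using this
  have hs0 : 0 < ‖s‖ := norm_pos_iff.mpr hne
  have hlim := (tendsto_norm_gammaRatio_mul a b hm hδ hs).const_mul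
    (Real.exp (K * (3 * Real.pi)))
  rw [mul_one] at hlim
  have key : ‖gammaRatio a b s‖ * ‖s‖ ^ m ≤ Real.exp (K * (3 * Real.pi)) := by
    refine ge_of_tendsto' hlim fun n => (iterate_step_bound a b h hs n).trans ?_
    gcongr
    exact sum_one_div_one_add_sq_le _ _
  rw [Real.rpow_neg hs0.le, ← div_eq_mul_inv, le_div_iff₀ (Real.rpow_pos_of_pos hs0 m)]
  exact key

end GammaRatio

/-! ### Contour integrals over rectangles -/

section Contour

/-- The integral of `f` along the boundary of the rectangle `[x₀, x₁] × [y₀, y₁]`,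
counterclockwise. -/
noncomputable def rectIntegral (f : ℂ → ℂ) (x₀ x₁ y₀ y₁ : ℝ) : ℂ :=
  (∫ x in x₀..x₁, f (x + y₀ * I)) - (∫ x in x₀..x₁, f (x + y₁ * I))
    + I * (∫ y in y₀..y₁, f (x₁ + y * I)) - I * (∫ y in y₀..y₁, f (x₀ + y * I))

lemma rectIntegral_eq_zero {f : ℂ → ℂ} {x₀ x₁ y₀ y₁ : ℝ}
    (h : DifferentiableOn ℂ f ([[x₀, x₁]] ×ℂ [[y₀, y₁]])) : rectIntegral f x₀ x₁ y₀ y₁ = 0 :=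
  Complex.integral_boundary_rect_eq_zero_of_differentiableOn f ⟨x₀, y₀⟩ ⟨x₁, y₁⟩ h

lemma intervalIntegrable_horizontal {f : ℂ → ℂ} {x₀ x₁ y : ℝ}
    (h : ∀ x ∈ [[x₀, x₁]], ContinuousAt f (x + y * I)) :
    IntervalIntegrable (fun x : ℝ => f (x + y * I)) MeasureTheory.volume x₀ x₁ := by
  refine ContinuousOn.intervalIntegrable fun x hx => ContinuousAt.continuousWithinAt ?_
  exact ContinuousAt.comp (f := fun x : ℝ => (x : ℂ) + y * I) (h x hx) (by fun_prop)

lemma intervalIntegrable_vertical {f : ℂ → ℂ} {x y₀ y₁ : ℝ}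
    (h : ∀ y ∈ [[y₀, y₁]], ContinuousAt f (x + y * I)) :
    IntervalIntegrable (fun y : ℝ => f (x + y * I)) MeasureTheory.volume y₀ y₁ := by
  refine ContinuousOn.intervalIntegrable fun y hy => ContinuousAt.continuousWithinAt ?_
  exact ContinuousAt.comp (f := fun y : ℝ => (x : ℂ) + y * I) (h y hy) (by fun_prop)

/-- A horizontal line off the real axis stays in the slit plane of the principal logarithm. -/
lemma integral_horizontal_inv {s x₀ x₁ y : ℝ} (hy : y ≠ 0) :
    ∫ x in x₀..x₁, ((x : ℂ) + y * I - s)⁻¹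
      = log ((x₁ : ℂ) + y * I - s) - log ((x₀ : ℂ) + y * I - s) := by
  have hne : ∀ x : ℝ, (x : ℂ) + y * I - s ∈ slitPlane := fun x => Or.inr (by simpa using hy)
  refine intervalIntegral.integral_eq_sub_of_hasDerivAt
    (f := fun x : ℝ => log ((x : ℂ) + y * I - s)) (fun x _ => ?_) ?_
  · have h1 : HasDerivAt (fun x : ℝ => (x : ℂ) + y * I - s) 1 x :=
      ((hasDerivAt_id x).ofReal_comp.add_const _).sub_const _
    simpa using h1.clog_real (hne x)
  · refine ContinuousOn.intervalIntegrable fun x _ => ContinuousAt.continuousWithinAt ?_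
    exact ContinuousAt.inv₀ (by fun_prop) (slitPlane_ne_zero (hne x))

lemma I_mul_integral_vertical_inv_of_lt {s x y₀ y₁ : ℝ} (hx : s < x) :
    I * ∫ y in y₀..y₁, ((x : ℂ) + y * I - s)⁻¹
      = log ((x : ℂ) + y₁ * I - s) - log ((x : ℂ) + y₀ * I - s) := by
  have hne : ∀ y : ℝ, (x : ℂ) + y * I - s ∈ slitPlane := fun y => Or.inl (by simpa using hx)
  rw [← intervalIntegral.integral_const_mul]
  refine intervalIntegral.integral_eq_sub_of_hasDerivAt
    (f := fun y : ℝ => log ((x : ℂ) + y * I - s)) (fun y _ => ?_) ?_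
  · have h1 : HasDerivAt (fun y : ℝ => (x : ℂ) + y * I - s) I y := by
      simpa using (((hasDerivAt_id y).ofReal_comp.mul_const I).const_add (x : ℂ)).sub_const (s : ℂ)
    simpa [div_eq_mul_inv] using h1.clog_real (hne y)
  · refine ContinuousOn.intervalIntegrable fun y _ => ContinuousAt.continuousWithinAt ?_
    exact continuousAt_const.mul (ContinuousAt.inv₀ (by fun_prop) (slitPlane_ne_zero (hne y)))

/-- On the left of `s` the primitive is `log (-(w - s))`, since `w - s` crosses the cut of `log`. -/
lemma I_mul_integral_vertical_inv_of_gt {s x y₀ y₁ : ℝ} (hx : x < s) :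
    I * ∫ y in y₀..y₁, ((x : ℂ) + y * I - s)⁻¹
      = log (-((x : ℂ) + y₁ * I - s)) - log (-((x : ℂ) + y₀ * I - s)) := by
  have hne : ∀ y : ℝ, -((x : ℂ) + y * I - s) ∈ slitPlane := fun y => Or.inl (by simpa using hx)
  rw [← intervalIntegral.integral_const_mul]
  refine intervalIntegral.integral_eq_sub_of_hasDerivAt
    (f := fun y : ℝ => log (-((x : ℂ) + y * I - s))) (fun y _ => ?_) ?_
  · have h1 : HasDerivAt (fun y : ℝ => -((x : ℂ) + y * I - s)) (-I) y := by
      have := (((hasDerivAt_id y).ofReal_comp.mul_const I).const_add (x : ℂ)).sub_const (s : ℂ)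
      rw [ofReal_one, one_mul] at this
      exact this.neg
    have h2 := h1.clog_real (hne y)
    rwa [neg_div_neg_eq, div_eq_mul_inv] at h2
  · refine ContinuousOn.intervalIntegrable fun y _ => ContinuousAt.continuousWithinAt ?_
    have h0 : (x : ℂ) + y * I - s ≠ 0 := neg_ne_zero.mp (slitPlane_ne_zero (hne y))
    exact continuousAt_const.mul (ContinuousAt.inv₀ (by fun_prop) h0)

lemma log_sub_log_neg_of_im_pos {z : ℂ} (hz : 0 < z.im) : log z - log (-z) = Real.pi * I := by
  rw [log, log, norm_neg, Complex.arg_neg_eq_arg_sub_pi_of_im_pos hz]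
  push_cast
  ring

/-- The two branches of the logarithm differ by `πi` at both left corners. -/
lemma rectIntegral_inv {s x₀ x₁ y₀ y₁ : ℝ} (h₀ : x₀ < s) (h₁ : s < x₁) (hy₀ : y₀ < 0)
    (hy₁ : 0 < y₁) :
    rectIntegral (fun w => (w - s)⁻¹) x₀ x₁ y₀ y₁ = 2 * Real.pi * I := by
  rw [rectIntegral, integral_horizontal_inv hy₀.ne, integral_horizontal_inv hy₁.ne',
    I_mul_integral_vertical_inv_of_lt h₁, I_mul_integral_vertical_inv_of_gt h₀]
  have e1 := log_sub_log_neg_of_im_pos (z := (x₀ : ℂ) + y₁ * I - s) (by simpa using hy₁)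
  have e2 := log_sub_log_neg_of_im_pos (z := -((x₀ : ℂ) + y₀ * I - s)) (by simpa using hy₀)
  rw [neg_neg] at e2
  linear_combination e1 + e2

/-- Cauchy's integral formula for a rectangle and a point of the real axis inside it. -/
lemma rectIntegral_div_sub {f : ℂ → ℂ} {s x₀ x₁ y₀ y₁ : ℝ} (h₀ : x₀ < s) (h₁ : s < x₁)
    (hy₀ : y₀ < 0) (hy₁ : 0 < y₁)
    (hf : ∀ w ∈ [[x₀, x₁]] ×ℂ [[y₀, y₁]], DifferentiableAt ℂ f w) :
    rectIntegral (fun w => f w / (w - s)) x₀ x₁ y₀ y₁ = 2 * Real.pi * I * f s := by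
  have hx : x₀ ≤ x₁ := (h₀.trans h₁).le
  have hy : y₀ ≤ y₁ := (hy₀.trans hy₁).le
  have hnhds : [[x₀, x₁]] ×ℂ [[y₀, y₁]] ∈ 𝓝 (s : ℂ) := by
    rw [uIcc_of_le hx, uIcc_of_le hy]
    refine Filter.inter_mem (Complex.continuous_re.continuousAt.preimage_mem_nhds ?_)
      (Complex.continuous_im.continuousAt.preimage_mem_nhds ?_)
    · simpa using Icc_mem_nhds h₀ h₁
    · simpa using Icc_mem_nhds hy₀ hy₁
  have hd := rectIntegral_eq_zero ((Complex.differentiableOn_dslope hnhds).mpr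
    fun w hw => (hf w hw).differentiableWithinAt)
  have hI := rectIntegral_inv h₀ h₁ hy₀ hy₁
  have e : ∀ w : ℂ, w ≠ s → dslope f s w = f w / (w - s) - f s * (w - s)⁻¹ := fun w hw => by
    rw [dslope_of_ne _ hw, slope_def_field]
    ring
  have hneH : ∀ (y : ℝ), y ≠ 0 → ∀ x : ℝ, (x : ℂ) + y * I ≠ s := fun y hy x h =>
    hy (by simpa using congrArg im h)
  have hneV : ∀ (x : ℝ), x ≠ s → ∀ y : ℝ, (x : ℂ) + y * I ≠ s := fun x hx y h =>
    hx (by simpa using congrArg re h)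
  have c1 : ∀ w ∈ [[x₀, x₁]] ×ℂ [[y₀, y₁]], w ≠ s → ContinuousAt (fun w => f w / (w - s)) w :=
    fun w hw hne => (hf w hw).continuousAt.div (by fun_prop) (sub_ne_zero.mpr hne)
  have c2 : ∀ w : ℂ, w ≠ s → ContinuousAt (fun w : ℂ => f s * (w - s)⁻¹) w :=
    fun w hne => continuousAt_const.mul (ContinuousAt.inv₀ (by fun_prop) (sub_ne_zero.mpr hne))
  have H : ∀ y : ℝ, y ≠ 0 → y ∈ [[y₀, y₁]] → ∫ x in x₀..x₁, dslope f s (x + y * I)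
      = (∫ x in x₀..x₁, f (x + y * I) / (x + y * I - s))
        - f s * ∫ x in x₀..x₁, ((x : ℂ) + y * I - s)⁻¹ := fun y hy0 hym => by
    rw [← intervalIntegral.integral_const_mul, ← intervalIntegral.integral_sub
      (intervalIntegrable_horizontal (f := fun w => f w / (w - s)) fun x hx =>
        c1 _ (by simpa [mem_reProdIm] using ⟨hx, hym⟩) (hneH y hy0 x))
      (intervalIntegrable_horizontal (f := fun w : ℂ => f s * (w - s)⁻¹) fun x _ =>
        c2 _ (hneH y hy0 x))]
    exact intervalIntegral.integral_congr fun x _ => e _ (hneH y hy0 x)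
  have V : ∀ x : ℝ, x ≠ s → x ∈ [[x₀, x₁]] → ∫ y in y₀..y₁, dslope f s (x + y * I)
      = (∫ y in y₀..y₁, f (x + y * I) / (x + y * I - s))
        - f s * ∫ y in y₀..y₁, ((x : ℂ) + y * I - s)⁻¹ := fun x hx0 hxm => by
    rw [← intervalIntegral.integral_const_mul, ← intervalIntegral.integral_sub
      (intervalIntegrable_vertical (f := fun w => f w / (w - s)) fun y hy =>
        c1 _ (by simpa [mem_reProdIm] using ⟨hxm, hy⟩) (hneV x hx0 y))
      (intervalIntegrable_vertical (f := fun w : ℂ => f s * (w - s)⁻¹) fun y _ =>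
        c2 _ (hneV x hx0 y))]
    exact intervalIntegral.integral_congr fun y _ => e _ (hneV x hx0 y)
  rw [rectIntegral, H y₀ hy₀.ne left_mem_uIcc, H y₁ hy₁.ne' right_mem_uIcc,
    V x₀ h₀.ne left_mem_uIcc, V x₁ h₁.ne' right_mem_uIcc] at hd
  rw [rectIntegral] at hI ⊢
  linear_combination hd + f s * hI

lemma norm_integral_le_of_abs_le {f : ℝ → ℂ} {u v R B : ℝ} (hB : 0 ≤ B) (hu : |u| ≤ R)
    (hv : |v| ≤ R) (h : ∀ t, |t| ≤ R → t ∈ uIcc u v → ‖f t‖ ≤ B) :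
    ‖∫ t in u..v, f t‖ ≤ B * (2 * R) := by
  refine (intervalIntegral.norm_integral_le_of_norm_le_const fun t ht => h t ?_ ?_).trans ?_
  · have ht' := uIoc_subset_uIcc ht
    rw [abs_le] at hu hv ⊢
    rcases mem_uIcc.mp ht' with h | h <;> constructor <;> linarith
  · exact uIoc_subset_uIcc ht
  · gcongr
    rw [abs_le] at *
    constructor <;> linarith

/-- Let `f` be holomorphic outside the half-strip on the left of `c` and between the lines
`Im w = α` and `Im w = β`, and let it decay like a negative power. Its integral over the loop
around the half-strip against the Cauchy kernel `1 / (s - w)` is `2πi f(s)`: the loop, truncated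
at `Re w = -R`, is pushed to the boundary of the square of half side `R`. -/
theorem tendsto_truncated_loop_integral {f : ℂ → ℂ} {c α β s δ N C m : ℝ} (hα : α < 0)
    (hβ : 0 < β) (hs : c < s)
    (hf : ∀ w : ℂ, w.im ≠ 0 ∨ c ≤ w.re → DifferentiableAt ℂ f w) (hm : 0 < m) (hC : 0 ≤ C)
    (hδα : δ ≤ -α) (hδβ : δ ≤ β)
    (hbound : ∀ w : ℂ, δ ≤ |w.im| ∨ N ≤ w.re → ‖f w‖ ≤ C * ‖w‖ ^ (-m)) :
    Tendsto (fun R : ℝ => (∫ x in -R..c, f (x + α * I) / (s - (x + α * I)))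
      + I * (∫ y in α..β, f (c + y * I) / (s - (c + y * I)))
      - ∫ x in -R..c, f (x + β * I) / (s - (x + β * I))) atTop (𝓝 (2 * Real.pi * I * f s)) := by
  set g : ℂ → ℂ := fun w => f w / (s - w) with hg
  have hgd : ∀ w : ℂ, w.im ≠ 0 ∨ s < w.re ∨ w.re < s ∧ c ≤ w.re → DifferentiableAt ℂ g w := by
    intro w hw
    have hne : (s : ℂ) - w ≠ 0 := by
      intro h
      have h1 : s - w.re = 0 := by simpa using congrArg re h
      have h2 : w.im = 0 := by simpa using congrArg im h
      rcases hw with h | h | h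
      · exact h h2
      · linarith
      · linarith
    refine (hf w ?_).div (by fun_prop) hne
    rcases hw with h | h | h
    · exact Or.inl h
    · exact Or.inr (by linarith)
    · exact Or.inr h.2
  -- the seven outer sides are bounded by `4 C R ^ (-m)` each
  have hmain : ∀ᶠ R : ℝ in atTop, ‖((∫ x in -R..c, g (x + α * I))
      + I * (∫ y in α..β, g (c + y * I)) - ∫ x in -R..c, g (x + β * I))
      - 2 * Real.pi * I * f s‖ ≤ 28 * C * R ^ (-m) := by
    filter_upwards [eventually_gt_atTop (2 * |s|), eventually_gt_atTop |c|,
      eventually_gt_atTop (-α), eventually_gt_atTop β, eventually_ge_atTop N,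
      eventually_gt_atTop 0] with R hRs hRc hRα hRβ hRN hR0
    have hs' := abs_le.mp (le_refl |s|)
    have hc' := abs_lt.mp hRc
    have hsR : s < R := by linarith [abs_nonneg s]
    have hBot := rectIntegral_eq_zero (f := g) (x₀ := -R) (x₁ := R) (y₀ := -R) (y₁ := α) (by
      intro w hw
      refine (hgd w (Or.inl ?_)).differentiableWithinAt
      have := hw.2
      rw [mem_preimage, uIcc_of_le (by linarith)] at this
      linarith [this.2])
    have hTop := rectIntegral_eq_zero (f := g) (x₀ := -R) (x₁ := R) (y₀ := β) (y₁ := R) (by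
      intro w hw
      refine (hgd w (Or.inl ?_)).differentiableWithinAt
      have := hw.2
      rw [mem_preimage, uIcc_of_le (by linarith)] at this
      linarith [this.1])
    have hRight := rectIntegral_div_sub (f := f) hs hsR hα hβ (by
      intro w hw
      refine hf w (Or.inr ?_)
      have := hw.1
      rw [mem_preimage, uIcc_of_le (by linarith)] at this
      exact this.1)
    have hneg : ∀ w : ℂ, f w / (w - s) = -g w := fun w => by
      rw [hg]
      simp only
      rw [← neg_sub, div_neg]
    -- three rectangles fill the square outside the half-strip; only the right one contains `s`
    simp only [rectIntegral, hneg, intervalIntegral.integral_neg] at hBot hTop hRight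
    have hint : ∀ y : ℝ, y ≠ 0 → ∀ u v : ℝ, IntervalIntegrable (fun x : ℝ => g (x + y * I))
        MeasureTheory.volume u v := fun y hy u v =>
      intervalIntegrable_horizontal fun x _ => (hgd _ (Or.inl (by simpa using hy))).continuousAt
    have hα2 := intervalIntegral.integral_add_adjacent_intervals (hint α hα.ne (-R) c)
      (hint α hα.ne c R)
    have hβ2 := intervalIntegral.integral_add_adjacent_intervals (hint β hβ.ne' (-R) c)
      (hint β hβ.ne' c R)
    have hgb : ∀ w : ℂ, δ ≤ |w.im| ∨ N ≤ w.re → (|w.re| = R ∨ |w.im| = R) →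
        ‖g w‖ ≤ 2 * C * R ^ (-m) / R := by
      intro w hw hwR
      have h1 : R ≤ ‖w‖ := by
        rcases hwR with h | h
        · rw [← h]; exact Complex.abs_re_le_norm w
        · rw [← h]; exact Complex.abs_im_le_norm w
      have h2 : R / 2 ≤ ‖(s : ℂ) - w‖ := by
        have := norm_sub_norm_le w (s : ℂ)
        rw [Complex.norm_real, Real.norm_eq_abs, norm_sub_rev] at this
        linarith
      have h3 : ‖w‖ ^ (-m) ≤ R ^ (-m) := Real.rpow_le_rpow_of_nonpos hR0 h1 (by linarith)
      calc ‖g w‖ = ‖f w‖ / ‖(s : ℂ) - w‖ := norm_div _ _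
        _ ≤ C * R ^ (-m) / (R / 2) := by
            refine div_le_div₀ (by positivity) ((hbound w hw).trans ?_) (by positivity) h2
            gcongr
        _ = _ := by field_simp
    have hB0 : 0 ≤ 2 * C * R ^ (-m) / R := by positivity
    have hBR : 2 * C * R ^ (-m) / R * (2 * R) = 4 * C * R ^ (-m) := by field_simp; ring
    have aR : |R| = R := abs_of_pos hR0
    have anR : |-R| = R := by rw [abs_neg, aR]
    have aα : |α| ≤ R := by rw [abs_of_neg hα]; exact hRα.le
    have aβ : |β| ≤ R := by rw [abs_of_pos hβ]; exact hRβ.le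
    have hδR : δ ≤ R := by linarith
    have b1 : ‖∫ x in -R..R, g (x + (-R : ℝ) * I)‖ ≤ 4 * C * R ^ (-m) := hBR ▸
      norm_integral_le_of_abs_le hB0 anR.le aR.le fun t _ _ =>
        hgb _ (by simp [aR, hδR]) (by simp [aR])
    have b2 : ‖∫ x in -R..R, g (x + R * I)‖ ≤ 4 * C * R ^ (-m) := hBR ▸
      norm_integral_le_of_abs_le hB0 anR.le aR.le fun t _ _ =>
        hgb _ (by simp [aR, hδR]) (by simp [aR])
    have b3 : ‖∫ y in -R..α, g (R + y * I)‖ ≤ 4 * C * R ^ (-m) := hBR ▸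
      norm_integral_le_of_abs_le hB0 anR.le aα fun t _ _ =>
        hgb _ (by simp [hRN]) (by simp [aR])
    have b4 : ‖∫ y in α..β, g (R + y * I)‖ ≤ 4 * C * R ^ (-m) := hBR ▸
      norm_integral_le_of_abs_le hB0 aα aβ fun t _ _ =>
        hgb _ (by simp [hRN]) (by simp [aR])
    have b5 : ‖∫ y in β..R, g (R + y * I)‖ ≤ 4 * C * R ^ (-m) := hBR ▸
      norm_integral_le_of_abs_le hB0 aβ aR.le fun t _ _ =>
        hgb _ (by simp [hRN]) (by simp [aR])
    have b6 : ‖∫ y in -R..α, g ((-R : ℝ) + y * I)‖ ≤ 4 * C * R ^ (-m) := hBR ▸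
      norm_integral_le_of_abs_le hB0 anR.le aα fun t _ ht =>
        hgb _ (Or.inl (by
          rw [uIcc_of_le (by linarith)] at ht
          simpa using Or.inr (show δ ≤ -t by linarith [ht.2]) |> le_abs.mpr)) (by simp [aR])
    have b7 : ‖∫ y in β..R, g ((-R : ℝ) + y * I)‖ ≤ 4 * C * R ^ (-m) := hBR ▸
      norm_integral_le_of_abs_le hB0 aβ aR.le fun t _ ht =>
        hgb _ (Or.inl (by
          rw [uIcc_of_le (by linarith)] at ht
          simpa using Or.inl (show δ ≤ t by linarith [ht.1]) |> le_abs.mpr)) (by simp [aR])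
    have hsplit : ((∫ x in -R..c, g (x + α * I))
        + I * (∫ y in α..β, g (c + y * I)) - ∫ x in -R..c, g (x + β * I)) - 2 * Real.pi * I * f s
        = (∫ x in -R..R, g (x + (-R : ℝ) * I)) - (∫ x in -R..R, g (x + R * I))
          + I * (∫ y in -R..α, g (R + y * I)) + I * (∫ y in α..β, g (R + y * I))
          + I * (∫ y in β..R, g (R + y * I)) - I * (∫ y in -R..α, g ((-R : ℝ) + y * I))
          - I * (∫ y in β..R, g ((-R : ℝ) + y * I)) := by
      linear_combination (-1 : ℂ) * hBot - hTop + hRight + hα2 - hβ2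
    rw [hsplit]
    have hI : ∀ z : ℂ, ‖I * z‖ = ‖z‖ := fun z => by rw [norm_mul, norm_I, one_mul]
    refine (norm_sub_le _ _).trans ?_
    refine (add_le_add_left ((norm_sub_le _ _).trans (add_le_add_left ((norm_add_le _ _).trans
      (add_le_add_left ((norm_add_le _ _).trans (add_le_add_left ((norm_add_le _ _).trans
      (add_le_add_left (norm_sub_le _ _) _)) _)) _)) _)) _).trans ?_
    simp only [hI]
    linarith
  rw [tendsto_iff_norm_sub_tendsto_zero]
  refine squeeze_zero' (Eventually.of_forall fun _ => norm_nonneg _) hmain ?_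
  simpa using (tendsto_rpow_neg_atTop hm).const_mul (28 * C)

end Contour

/-! ### Superpositions of powers -/

section Loop

open MeasureTheory in
/-- Fubini's theorem for a superposition `∫ m(v) ξ ^ (-w(v)) dν(v)` of powers: its Mellin transform
over `(0, 1)` is the superposition of the transforms `1 / (s - w(v))`. -/
theorem integrableOn_and_integral_superposition (ν : Measure ℝ) [SFinite ν] {m w : ℝ → ℂ}
    (hm : AEStronglyMeasurable m ν) (hw : Measurable w) (hre : ∀ᵐ v ∂ν, (w v).re < 0)
    (hint : Integrable (fun v => ‖m v‖ / (w v).re) ν) {s : ℝ} (hs : 0 ≤ s) :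
    IntegrableOn (fun ξ : ℝ => ∫ v, m v * (ξ : ℂ) ^ ((s : ℂ) - w v - 1) ∂ν) (Ioo 0 1) ∧
      ∫ ξ in Ioo (0 : ℝ) 1, ∫ v, m v * (ξ : ℂ) ^ ((s : ℂ) - w v - 1) ∂ν
        = ∫ v, m v / (s - w v) ∂ν := by
  have hmeas : AEStronglyMeasurable (fun z : ℝ × ℝ => m z.2 * (z.1 : ℂ) ^ ((s : ℂ) - w z.2 - 1))
      ((volume.restrict (Ioo 0 1)).prod ν) := by
    refine hm.comp_snd.mul (Measurable.aestronglyMeasurable ?_)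
    fun_prop
  have hI : ∀ r : ℂ, -1 < r.re → IntegrableOn (fun ξ : ℝ => (ξ : ℂ) ^ r) (Ioo 0 1) := fun r hr =>
    ((intervalIntegrable_iff_integrableOn_Ioo_of_le zero_le_one).mp
      (intervalIntegral.intervalIntegrable_cpow' hr))
  have hIv : ∀ r : ℂ, -1 < r.re → ∫ ξ in Ioo (0 : ℝ) 1, (ξ : ℂ) ^ r = 1 / (r + 1) := by
    intro r hr
    have h0 : r + 1 ≠ 0 := fun h => by
      have := congrArg re h
      simp only [add_re, one_re, zero_re] at this
      linarith
    rw [← integral_Ioc_eq_integral_Ioo, ← intervalIntegral.integral_of_le zero_le_one,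
      integral_cpow (Or.inl hr)]
    simp [zero_cpow h0]
  have hnorm : ∀ r : ℂ, -1 < r.re → ∫ ξ in Ioo (0 : ℝ) 1, ‖(ξ : ℂ) ^ r‖ = 1 / (r.re + 1) := by
    intro r hr
    rw [setIntegral_congr_fun measurableSet_Ioo (fun ξ hξ => norm_cpow_eq_rpow_re_of_pos hξ.1 r),
      ← integral_Ioc_eq_integral_Ioo, ← intervalIntegral.integral_of_le zero_le_one,
      integral_rpow (Or.inl hr)]
    rw [Real.zero_rpow (by linarith)]
    simp
  have hrex : ∀ v, (w v).re < 0 → -1 < ((s : ℂ) - w v - 1).re := fun v hv => by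
    simp only [sub_re, ofReal_re, one_re]
    linarith
  have hprod : Integrable (fun z : ℝ × ℝ => m z.2 * (z.1 : ℂ) ^ ((s : ℂ) - w z.2 - 1))
      ((volume.restrict (Ioo 0 1)).prod ν) := by
    rw [integrable_prod_iff' hmeas]
    constructor
    · filter_upwards [hre] with v hv
      exact (hI _ (hrex v hv)).const_mul _
    · refine hint.norm.mono' hmeas.norm.prod_swap.integral_prod_right' ?_
      filter_upwards [hre] with v hv
      have h1 : ∫ ξ in Ioo (0 : ℝ) 1, ‖m v * (ξ : ℂ) ^ ((s : ℂ) - w v - 1)‖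
          = ‖m v‖ * (1 / (s - (w v).re)) := by
        simp only [norm_mul]
        rw [integral_const_mul, hnorm _ (hrex v hv)]
        simp
      change ‖∫ ξ in Ioo (0 : ℝ) 1, ‖m v * (ξ : ℂ) ^ ((s : ℂ) - w v - 1)‖‖ ≤ _
      rw [h1, norm_div, norm_norm, mul_one_div, norm_div, norm_norm, Real.norm_eq_abs,
        Real.norm_eq_abs, abs_of_neg hv, abs_of_pos (by linarith)]
      exact div_le_div_of_nonneg_left (norm_nonneg _) (by linarith) (by linarith)
  refine ⟨hprod.integral_prod_left, ?_⟩
  rw [integral_integral_swap hprod]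
  refine integral_congr_ae ?_
  filter_upwards [hre] with v hv
  rw [integral_const_mul, hIv _ (hrex v hv), sub_add_cancel, mul_one_div]

lemma integrableOn_Iic_neg_rpow {r c : ℝ} (hr : r < -1) (hc : c < 0) :
    MeasureTheory.IntegrableOn (fun v : ℝ => (-v) ^ r) (Iic c) := by
  have h := (integrableOn_Ioi_rpow_of_lt hr (neg_pos.mpr hc))
  rw [← integrableOn_Ici_iff_integrableOn_Ioi] at h
  simpa using h.comp_neg_Iic

/-! ### Meijer's function as a loop integral -/

variable {p : ℕ} {a : Fin p → ℝ}

lemma differentiableAt_gammaRatio (b : Fin p → ℝ) {s : ℂ} (hs : ∀ i (n : ℕ), (a i : ℂ) + s ≠ -n) :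
    DifferentiableAt ℂ (gammaRatio a b) s := by
  have h : gammaRatio a b
      = fun s => (∏ i, Gamma ((a i : ℂ) + s)) * ∏ j, (Gamma ((b j : ℂ) + s))⁻¹ := by
    funext s
    rw [gammaRatio, div_eq_mul_inv, Finset.prod_inv_distrib]
  rw [h]
  refine DifferentiableAt.mul ?_ ?_
  · refine DifferentiableAt.fun_finsetProd fun i _ => ?_
    exact (Complex.differentiableAt_Gamma _ (hs i)).comp s (by fun_prop)
  · refine DifferentiableAt.fun_finsetProd fun j _ => ?_
    exact (Complex.differentiable_one_div_Gamma _).comp s (by fun_prop)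

/-- A left loop and the exterior of the half-strip inside it avoid all the poles. -/
lemma LeftLoop.differentiableAt_gammaRatio (L : LeftLoop a) (b : Fin p → ℝ) {s : ℂ}
    (hs : s.im ≠ 0 ∨ L.c ≤ s.re) : DifferentiableAt ℂ (gammaRatio a b) s := by
  refine FoxWright.differentiableAt_gammaRatio b fun i n h => ?_
  have h1 := congrArg re h
  have h2 := congrArg im h
  simp only [add_re, add_im, ofReal_re, ofReal_im, neg_re, neg_im, natCast_re, natCast_im] at h1 h2
  rcases hs with h' | h'
  · exact h' (by linarith)
  · have h3 := L.poles_left i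
    have h4 : (0 : ℝ) ≤ n := n.cast_nonneg
    linarith

lemma LeftLoop.differentiableAt_integrand (L : LeftLoop a) (b : Fin p → ℝ) {x : ℝ} (hx : 0 < x)
    {s : ℂ} (hs : s.im ≠ 0 ∨ L.c ≤ s.re) : DifferentiableAt ℂ (meijerGIntegrand a b x) s := by
  refine (L.differentiableAt_gammaRatio b hs).mul ?_
  exact differentiableAt_id.neg.const_cpow (Or.inl (by exact_mod_cast hx.ne'))

lemma exists_norm_gammaRatio_horizontal_le (b : Fin p → ℝ) (hmu : 0 < mu a b) {α : ℝ}
    (hα : α ≠ 0) :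
    ∃ C, 0 < C ∧ ∀ v : ℝ, ‖gammaRatio a b (v + α * I)‖ ≤ C * ‖(v : ℂ) + α * I‖ ^ (-mu a b) := by
  obtain ⟨C, hC, h⟩ := exists_norm_gammaRatio_le a b (abs_pos.mpr hα) (m := mu a b)
    (by simp [mu]) hmu.le
  exact ⟨C, hC, fun v => h _ (Or.inl (by simp))⟩

lemma continuous_gammaRatio_horizontal (L : LeftLoop a) (b : Fin p → ℝ) {α : ℝ} (hα : α ≠ 0) :
    Continuous fun v : ℝ => gammaRatio a b (v + α * I) :=
  continuous_iff_continuousAt.mpr fun v =>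
    ContinuousAt.comp (f := fun v : ℝ => (v : ℂ) + α * I)
      (L.differentiableAt_gammaRatio b (Or.inl (by simpa using hα))).continuousAt (by fun_prop)

lemma continuous_gammaRatio_vertical (L : LeftLoop a) (b : Fin p → ℝ) :
    Continuous fun y : ℝ => gammaRatio a b (L.c + y * I) :=
  continuous_iff_continuousAt.mpr fun v =>
    ContinuousAt.comp (f := fun v : ℝ => (L.c : ℂ) + v * I)
      (L.differentiableAt_gammaRatio b (Or.inr (by simp))).continuousAt (by fun_prop)

lemma integrableOn_integrand_horizontal (L : LeftLoop a) (b : Fin p → ℝ) (hmu : 0 < mu a b)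
    {α : ℝ} (hα : α ≠ 0) {x : ℝ} (hx : x ∈ Ioo 0 1) (c : ℝ) :
    MeasureTheory.IntegrableOn (fun v : ℝ => meijerGIntegrand a b x (v + α * I)) (Iic c) := by
  obtain ⟨C, hC, h⟩ := exists_norm_gammaRatio_horizontal_le b hmu hα
  have hlog : 0 < -Real.log x := neg_pos.mpr (Real.log_neg hx.1 hx.2)
  refine ((integrableOn_exp_mul_Iic hlog c).const_mul (C * |α| ^ (-mu a b))).mono' ?_ ?_
  · refine Continuous.aestronglyMeasurable (continuous_iff_continuousAt.mpr fun v => ?_)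
    exact ContinuousAt.comp (f := fun v : ℝ => (v : ℂ) + α * I)
      (L.differentiableAt_integrand b hx.1 (Or.inl (by simpa using hα))).continuousAt (by fun_prop)
  · refine Eventually.of_forall fun v => ?_
    change ‖gammaRatio a b _ * (x : ℂ) ^ (-((v : ℂ) + α * I))‖ ≤ _
    rw [norm_mul, norm_cpow_eq_rpow_re_of_pos hx.1]
    have e : x ^ (-((v : ℂ) + α * I)).re = Real.exp (-Real.log x * v) := by
      rw [Real.rpow_def_of_pos hx.1]
      congr 1
      simp
    rw [e]
    refine mul_le_mul_of_nonneg_right ((h v).trans ?_) (Real.exp_pos _).le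
    refine mul_le_mul_of_nonneg_left ?_ hC.le
    exact Real.rpow_le_rpow_of_nonpos (abs_pos.mpr hα)
      (by simpa using Complex.abs_im_le_norm ((v : ℂ) + α * I)) (by linarith)

theorem LeftLoop.converges (L : LeftLoop a) (b : Fin p → ℝ) (hmu : 0 < mu a b) {x : ℝ}
    (hx : x ∈ Ioo 0 1) : L.Converges (meijerGIntegrand a b x) := by
  refine ⟨integrableOn_integrand_horizontal L b hmu L.α_neg.ne hx _, ?_,
    integrableOn_integrand_horizontal L b hmu L.β_pos.ne' hx _⟩
  exact intervalIntegrable_vertical fun y _ =>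
    (L.differentiableAt_integrand b hx.1 (Or.inr (by simp))).continuousAt

/-- The loop integral does not depend on the abscissa of the vertical segment. -/
theorem meijerG_eq_of_same_lines (L L' : LeftLoop a) (hα : L'.α = L.α) (hβ : L'.β = L.β)
    (b : Fin p → ℝ) (hmu : 0 < mu a b) {x : ℝ} (hx : x ∈ Ioo 0 1) :
    meijerG L b x = meijerG L' b x := by
  have hrect := rectIntegral_eq_zero (f := meijerGIntegrand a b x) (x₀ := L.c) (x₁ := L'.c)
    (y₀ := L.α) (y₁ := L.β) (by
      intro w hw
      have h1 := hw.1
      rw [mem_preimage, mem_uIcc] at h1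
      refine DifferentiableAt.differentiableWithinAt ?_
      rcases h1 with h | h
      · exact L.differentiableAt_integrand b hx.1 (Or.inr h.1)
      · exact L'.differentiableAt_integrand b hx.1 (Or.inr h.1))
  have h1 := intervalIntegral.integral_Iic_sub_Iic
    (integrableOn_integrand_horizontal L b hmu L.α_neg.ne hx L.c)
    (integrableOn_integrand_horizontal L b hmu L.α_neg.ne hx L'.c)
  have h2 := intervalIntegral.integral_Iic_sub_Iic
    (integrableOn_integrand_horizontal L b hmu L.β_pos.ne' hx L.c)
    (integrableOn_integrand_horizontal L b hmu L.β_pos.ne' hx L'.c)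
  rw [rectIntegral] at hrect
  rw [meijerG, meijerG, LeftLoop.integral, LeftLoop.integral, hα, hβ]
  congr 1
  linear_combination -h1 + h2 - hrect

/-- This is where `0 < μ` enters: along a horizontal ray the integrand is `O(|v| ^ (-μ - 1))`. -/
lemma integrableOn_norm_gammaRatio_div (L : LeftLoop a) (b : Fin p → ℝ) (hmu : 0 < mu a b)
    {α c : ℝ} (hα : α ≠ 0) (hc : c < 0) :
    MeasureTheory.IntegrableOn (fun v : ℝ => ‖gammaRatio a b (v + α * I)‖ / v) (Iic c) := by
  obtain ⟨C, hC, h⟩ := exists_norm_gammaRatio_horizontal_le b hmu hα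
  refine ((integrableOn_Iic_neg_rpow (r := -mu a b - 1) (by linarith) hc).const_mul C).mono' ?_ ?_
  · exact ((continuous_gammaRatio_horizontal L b hα).norm.measurable.div
      measurable_id).aestronglyMeasurable
  · refine MeasureTheory.ae_restrict_of_forall_mem measurableSet_Iic fun v hv => ?_
    have hv0 : 0 < -v := by linarith [mem_Iic.mp hv]
    rw [norm_div, norm_norm, Real.norm_eq_abs, abs_of_neg (by linarith), Real.rpow_sub_one hv0.ne',
      ← mul_div_assoc]
    refine div_le_div_of_nonneg_right ((h v).trans ?_) hv0.le
    refine mul_le_mul_of_nonneg_left ?_ hC.le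
    refine Real.rpow_le_rpow_of_nonpos hv0 ?_ (by linarith)
    have := Complex.abs_re_le_norm ((v : ℂ) + α * I)
    simp only [add_re, ofReal_re, mul_re, I_re, mul_zero, ofReal_im, I_im, mul_one, sub_self,
      add_zero] at this
    exact (neg_le_abs v).trans this

lemma integrableOn_gammaRatio_div_sub (L : LeftLoop a) (b : Fin p → ℝ) (hmu : 0 < mu a b)
    {α c s : ℝ} (hα : α ≠ 0) (hc : c < 0) (hs : 0 ≤ s) :
    MeasureTheory.IntegrableOn
      (fun v : ℝ => gammaRatio a b (v + α * I) / (s - (v + α * I))) (Iic c) := by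
  refine (integrableOn_norm_gammaRatio_div L b hmu hα hc).norm.mono' ?_ ?_
  · refine ((continuous_gammaRatio_horizontal L b hα).measurable.div
      ?_).aestronglyMeasurable
    fun_prop
  · refine MeasureTheory.ae_restrict_of_forall_mem measurableSet_Iic fun v hv => ?_
    have hv0 : v < 0 := lt_of_le_of_lt hv hc
    rw [norm_div, norm_div, norm_norm, Real.norm_eq_abs, abs_of_neg hv0]
    refine div_le_div_of_nonneg_left (norm_nonneg _) (by linarith) ?_
    have := Complex.re_le_norm ((s : ℂ) - (v + α * I))
    simp only [sub_re, add_re, ofReal_re, mul_re, I_re, mul_zero, ofReal_im, I_im, mul_one,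
      sub_self, add_zero] at this
    linarith

/-- The Cauchy transform of the quotient of Gamma functions along a left loop reproduces the
quotient on the right of the loop. -/
theorem LeftLoop.integral_gammaRatio_div (L : LeftLoop a) (hc : L.c < 0) (b : Fin p → ℝ)
    (hmu : 0 < mu a b) {s : ℝ} (hs : 0 ≤ s) :
    L.integral (fun w => gammaRatio a b w / (s - w)) = 2 * Real.pi * I * gammaRatio a b s := by
  have hδ : 0 < min (-L.α) L.β := lt_min (neg_pos.mpr L.α_neg) L.β_pos
  obtain ⟨C, hC, hbound⟩ := exists_norm_gammaRatio_le a b hδ (m := mu a b) (by simp [mu]) hmu.le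
  have h1 := tendsto_truncated_loop_integral (f := gammaRatio a b) L.α_neg L.β_pos
    (hc.trans_le hs) (fun w hw => L.differentiableAt_gammaRatio b hw) hmu hC.le
    (min_le_left _ _) (min_le_right _ _) hbound
  have hray : ∀ α : ℝ, α ≠ 0 → Tendsto (fun R : ℝ =>
      ∫ x in -R..L.c, gammaRatio a b (x + α * I) / (s - (x + α * I))) atTop
      (𝓝 (∫ x in Iic L.c, gammaRatio a b (x + α * I) / (s - (x + α * I)))) := fun α hα =>
    MeasureTheory.intervalIntegral_tendsto_integral_Iic L.c
      (integrableOn_gammaRatio_div_sub L b hmu hα hc hs) tendsto_neg_atTop_atBot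
  exact tendsto_nhds_unique
    (((hray _ L.α_neg.ne).add_const _).sub (hray _ L.β_pos.ne')) h1

lemma cpow_mul_integrand {b : Fin p → ℝ} {κ ξ : ℝ} (hξ : 0 < ξ) (s : ℝ) (w : ℂ) :
    (ξ : ℂ) ^ ((s : ℂ) - 1) * meijerGIntegrand a b (ξ ^ κ) w
      = gammaRatio a b w * (ξ : ℂ) ^ ((s : ℂ) - κ * w - 1) := by
  have hξ' : (ξ : ℂ) ≠ 0 := by exact_mod_cast hξ.ne'
  have h1 : ((ξ ^ κ : ℝ) : ℂ) ^ (-w) = (ξ : ℂ) ^ (-(κ * w)) := by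
    rw [cpow_def_of_ne_zero (by exact_mod_cast (Real.rpow_pos_of_pos hξ κ).ne'),
      cpow_def_of_ne_zero hξ', ← ofReal_log (Real.rpow_pos_of_pos hξ κ).le, ← ofReal_log hξ.le,
      Real.log_rpow hξ]
    push_cast
    ring_nf
  change _ * (gammaRatio a b w * ((ξ ^ κ : ℝ) : ℂ) ^ (-w)) = _
  rw [h1, mul_left_comm, ← cpow_add _ _ hξ']
  ring_nf

open MeasureTheory in
/-- The Mellin transform of Meijer's function over `(0, 1)`, after the substitution
`x = ξ ^ κ`. -/
theorem LeftLoop.mellin_meijerG (L : LeftLoop a) (hc : L.c < 0) (b : Fin p → ℝ)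
    (hmu : 0 < mu a b) {κ : ℝ} (hκ : 0 < κ) {s : ℝ} (hs : 0 ≤ s) :
    IntegrableOn (fun ξ : ℝ => (ξ : ℂ) ^ ((s : ℂ) - 1) * meijerG L b (ξ ^ κ)) (Ioo 0 1) ∧
      ∫ ξ in Ioo (0 : ℝ) 1, (ξ : ℂ) ^ ((s : ℂ) - 1) * meijerG L b (ξ ^ κ)
        = (κ : ℂ)⁻¹ * gammaRatio a b ((s / κ : ℝ) : ℂ) := by
  have hκ' : (κ : ℂ) ≠ 0 := by exact_mod_cast hκ.ne'
  have hray : ∀ α : ℝ, α ≠ 0 → _ := fun α hα =>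
    integrableOn_and_integral_superposition (volume.restrict (Iic L.c))
      (m := fun v => gammaRatio a b (v + α * I)) (w := fun v => κ * ((v : ℂ) + α * I))
      (continuous_gammaRatio_horizontal L b hα).aestronglyMeasurable (by fun_prop)
      (ae_restrict_of_forall_mem measurableSet_Iic fun v hv => by
        have hv0 : v < 0 := lt_of_le_of_lt hv hc
        simpa using mul_neg_of_pos_of_neg hκ hv0)
      (((integrableOn_norm_gammaRatio_div L b hmu hα hc).div_const κ).congr
        (Eventually.of_forall fun v => by simp [div_div, mul_comm])) hs
  have hseg := integrableOn_and_integral_superposition (volume.restrict (Ioc L.α L.β))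
      (m := fun y => gammaRatio a b (L.c + y * I)) (w := fun y => κ * ((L.c : ℂ) + y * I))
      (continuous_gammaRatio_vertical L b).aestronglyMeasurable (by fun_prop)
      (Eventually.of_forall fun v => by simpa using mul_neg_of_pos_of_neg hκ hc)
      (by
        have h1 : IntegrableOn (fun y : ℝ => ‖gammaRatio a b (L.c + y * I)‖) (Ioc L.α L.β) :=
          (continuous_gammaRatio_vertical L b).norm.integrableOn_Ioc
        simpa using h1.div_const (κ * L.c)) hs
  have hray1 := hray _ L.α_neg.ne
  have hray2 := hray _ L.β_pos.ne'
  have hαβ : L.α ≤ L.β := (L.α_neg.trans L.β_pos).le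
  have key : ∀ ξ ∈ Ioo (0 : ℝ) 1, 1 / (2 * (Real.pi : ℂ) * I) *
      ((∫ v in Iic L.c, gammaRatio a b (v + L.α * I)
          * (ξ : ℂ) ^ ((s : ℂ) - κ * ((v : ℂ) + L.α * I) - 1))
        + I * (∫ y in Ioc L.α L.β, gammaRatio a b (L.c + y * I)
          * (ξ : ℂ) ^ ((s : ℂ) - κ * ((L.c : ℂ) + y * I) - 1))
        - ∫ v in Iic L.c, gammaRatio a b (v + L.β * I)
          * (ξ : ℂ) ^ ((s : ℂ) - κ * ((v : ℂ) + L.β * I) - 1))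
      = (ξ : ℂ) ^ ((s : ℂ) - 1) * meijerG L b (ξ ^ κ) := by
    intro ξ hξ
    simp only [← cpow_mul_integrand hξ.1]
    rw [integral_const_mul, integral_const_mul, integral_const_mul, meijerG, LeftLoop.integral,
      intervalIntegral.integral_of_le hαβ]
    ring
  have hadd := Integrable.fun_add hray1.1 (hseg.1.const_mul I)
  have htot := (Integrable.sub hadd hray2.1).const_mul (1 / (2 * (Real.pi : ℂ) * I))
  refine ⟨htot.congr (ae_restrict_of_forall_mem measurableSet_Ioo key), ?_⟩
  rw [← setIntegral_congr_fun measurableSet_Ioo key, integral_const_mul,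
    integral_sub hadd hray2.1, integral_add hray1.1 (hseg.1.const_mul I), integral_const_mul,
    hray1.2, hray2.2, hseg.2]
  have hdiv : ∀ w : ℂ, gammaRatio a b w / (s - κ * w)
      = (κ : ℂ)⁻¹ * (gammaRatio a b w / (((s / κ : ℝ) : ℂ) - w)) := fun w => by
    rw [show (s : ℂ) - κ * w = κ * (((s / κ : ℝ) : ℂ) - w) by push_cast; field_simp,
      div_eq_mul_inv, mul_inv, div_eq_mul_inv]
    ring
  simp only [hdiv]
  rw [integral_const_mul, integral_const_mul, integral_const_mul]
  have hC := L.integral_gammaRatio_div hc b hmu (div_nonneg hs hκ.le)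
  rw [LeftLoop.integral, intervalIntegral.integral_of_le hαβ] at hC
  have hpi : (2 * (Real.pi : ℂ) * I) ≠ 0 := Complex.two_pi_I_ne_zero
  calc _ = 1 / (2 * (Real.pi : ℂ) * I) * (κ : ℂ)⁻¹
        * (2 * Real.pi * I * gammaRatio a b ((s / κ : ℝ) : ℂ)) := by rw [← hC]; ring
    _ = _ := by field_simp

end Loop

/-! ### The binomial series and the exchange of sum and integral -/

section Generating

lemma Gamma_add_natCast_eq (x : ℝ) (hx : ∀ n : ℕ, x ≠ -n) (n : ℕ) :
    Real.Gamma (x + n) = (ascPochhammer ℝ n).eval x * Real.Gamma x := by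
  induction n with
  | zero => simp
  | succ n ih =>
    rw [Nat.cast_succ, ← add_assoc, Real.Gamma_add_one (fun h => hx n (by linarith)), ih,
      ascPochhammer_succ_eval]
    ring

lemma gbinom_eq_choose {lam : ℝ} (hlam : 0 < lam) (k : ℕ) :
    gbinom (lam + k - 1) k = Ring.choose (lam + k - 1) k := by
  have h1 := Ring.factorial_nsmul_multichoose_eq_ascPochhammer lam k
  rw [Polynomial.ascPochhammer_smeval_eq_eval, Ring.multichoose_eq, nsmul_eq_mul] at h1
  have h2 := Gamma_add_natCast_eq lam (fun n h => by
    have : (0 : ℝ) ≤ n := n.cast_nonneg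
    linarith) k
  have h3 := (Real.Gamma_pos_of_pos hlam).ne'
  have h4 : (k.factorial : ℝ) ≠ 0 := by positivity
  rw [gbinom, sub_add_cancel, h2, ← h1, Real.Gamma_nat_eq_factorial,
    show lam + k - 1 - k + 1 = lam by ring]
  field_simp

lemma gbinom_nonneg {lam : ℝ} (hlam : 0 < lam) (k : ℕ) : 0 ≤ gbinom (lam + k - 1) k := by
  have h : (0 : ℝ) ≤ k := k.cast_nonneg
  rw [gbinom]
  refine div_nonneg (Real.Gamma_pos_of_pos (by linarith)).le (mul_nonneg ?_ ?_)
  · exact (Real.Gamma_pos_of_pos (by linarith)).le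
  · exact (Real.Gamma_pos_of_pos (by linarith)).le

/-- The binomial series of `(1 - y) ^ (-λ)`. -/
lemma hasSum_gbinom {lam : ℝ} (hlam : 0 < lam) {y : ℂ} (hy : ‖y‖ < 1) :
    HasSum (fun k : ℕ => (gbinom (lam + k - 1) k : ℂ) * y ^ k) ((1 - y) ^ (-(lam : ℂ))) := by
  have h := (Complex.one_div_one_sub_cpow_hasFPowerSeriesOnBall_zero (lam : ℂ)).hasSum (y := y)
    (by simpa [enorm_eq_nnnorm, ← NNReal.coe_lt_coe] using hy)
  rw [zero_add, one_div, ← cpow_neg] at h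
  refine h.congr_fun fun k => ?_
  symm
  rw [FormalMultilinearSeries.ofScalars_apply_eq, smul_eq_mul, gbinom_eq_choose hlam,
    Complex.ofReal_choose]
  push_cast
  rfl

lemma summable_gbinom_mul_pow {lam : ℝ} (hlam : 0 < lam) {r : ℝ} (hr0 : 0 ≤ r) (hr : r < 1) :
    Summable fun k : ℕ => gbinom (lam + k - 1) k * r ^ k := by
  have h := (hasSum_gbinom hlam (y := (r : ℂ)) (by simpa [abs_of_nonneg hr0] using hr)).summable
  exact_mod_cast h

open MeasureTheory in
/-- Termwise integration of a series with summable uniform bounds against an integrable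
function. -/
lemma hasSum_integral_mul_of_bound {X : Type*} [MeasurableSpace X] {ν : Measure X} {F g : X → ℂ}
    (hF : Integrable F ν) {f : ℕ → X → ℂ} {r : ℕ → ℝ} (hr : Summable r)
    (hmeas : ∀ n, AEStronglyMeasurable (f n) ν) (hb : ∀ n, ∀ᵐ x ∂ν, ‖f n x‖ ≤ r n)
    (hs : ∀ᵐ x ∂ν, HasSum (fun n => f n x) (g x)) :
    HasSum (fun n => ∫ x, f n x * F x ∂ν) (∫ x, g x * F x ∂ν) := by
  refine hasSum_integral_of_dominated_convergence (fun n x => r n * ‖F x‖)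
    (fun n => (hmeas n).mul hF.aestronglyMeasurable) (fun n => ?_)
    (Eventually.of_forall fun x => hr.mul_right _) ?_ ?_
  · filter_upwards [hb n] with x hx
    rw [norm_mul]
    gcongr
  · simp only [tsum_mul_right]
    exact hF.norm.const_mul _
  · filter_upwards [hs] with x hx
    exact hx.mul_right _

/-! ### The generating function -/

lemma rho_const (p : ℕ) {A : ℝ} (hA : 0 < A) :
    rho (fun _ : Fin p => A) (fun _ : Fin p => A) = 1 := by
  rw [rho, ← Finset.prod_mul_distrib]
  refine Finset.prod_eq_one fun _ _ => ?_
  rw [← Real.rpow_add hA, neg_add_cancel, Real.rpow_zero]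

variable {p : ℕ} {a : Fin p → ℝ}

lemma gammaRatio_ofReal (b : Fin p → ℝ) (s : ℝ) :
    gammaRatio a b s
      = (((∏ i, Real.Gamma (a i + s)) / (∏ j, Real.Gamma (b j + s)) : ℝ) : ℂ) := by
  rw [gammaRatio]
  push_cast
  simp only [← Complex.Gamma_ofReal, ofReal_add]

open MeasureTheory in
/-- The moments of `ξ⁻¹ G(ξ ^ (1 / A))` over `(0, 1)`, for an arbitrary left loop: as the `a_i`
are positive, the loop may be moved to one with `c < 0`, where the superposition of powers may be
integrated under the loop integral. -/
theorem integrableOn_and_moments (L : LeftLoop a) (b : Fin p → ℝ) (hmu : 0 < mu a b) {A : ℝ}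
    (hA : 0 < A) (ha : ∀ i, 1 ≤ a i / A) :
    IntegrableOn (fun ξ : ℝ => (ξ : ℂ)⁻¹ * meijerG L b (ξ ^ (1 / A))) (Ioo 0 1) ∧
      ∀ k : ℕ, ∫ ξ in Ioo (0 : ℝ) 1, (ξ : ℂ) ^ k * ((ξ : ℂ)⁻¹ * meijerG L b (ξ ^ (1 / A)))
        = A * gammaRatio a b ((k * A : ℝ) : ℂ) := by
  -- any abscissa in `(-A, 0)` would do, because `A ≤ a i` for all `i`
  let L' : LeftLoop a := ⟨-A / 2, L.α, L.β, L.α_neg, L.β_pos, fun i => by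
    have := (one_le_div hA).mp (ha i)
    linarith⟩
  have hκ : 0 < 1 / A := one_div_pos.mpr hA
  have hLL' : ∀ ξ ∈ Ioo (0 : ℝ) 1, meijerG L' b (ξ ^ (1 / A)) = meijerG L b (ξ ^ (1 / A)) :=
    fun ξ hξ => (meijerG_eq_of_same_lines L L' rfl rfl b hmu
      ⟨Real.rpow_pos_of_pos hξ.1 _, Real.rpow_lt_one hξ.1.le hξ.2 hκ⟩).symm
  have key (k : ℕ) := L'.mellin_meijerG (show -A / 2 < 0 by linarith) b hmu hκ
    (Nat.cast_nonneg k : (0 : ℝ) ≤ k)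
  have heq (k : ℕ) : ∀ ξ ∈ Ioo (0 : ℝ) 1,
      (ξ : ℂ) ^ (((k : ℝ) : ℂ) - 1) * meijerG L' b (ξ ^ (1 / A))
        = (ξ : ℂ) ^ k * ((ξ : ℂ)⁻¹ * meijerG L b (ξ ^ (1 / A))) := fun ξ hξ => by
    have hξ' : (ξ : ℂ) ≠ 0 := by exact_mod_cast hξ.1.ne'
    rw [hLL' ξ hξ, cpow_sub _ _ hξ', cpow_one, ofReal_natCast, cpow_natCast, div_eq_mul_inv,
      mul_assoc]
  constructor
  · refine (key 0).1.congr (ae_restrict_of_forall_mem measurableSet_Ioo fun ξ hξ => ?_)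
    simpa only [pow_zero, one_mul] using heq 0 ξ hξ
  · intro k
    rw [← setIntegral_congr_fun measurableSet_Ioo (heq k), (key k).2]
    simp

open MeasureTheory in
/-- The Fox-Wright series is the exponential series of `z ξ`, integrated termwise against
`ξ ^ (k - 1) G(ξ ^ (1 / A))`. -/
theorem hasSum_foxWrightTerm (L : LeftLoop a) (b : Fin p → ℝ) (hmu : 0 < mu a b) {A : ℝ}
    (hA : 0 < A) (ha : ∀ i, 1 ≤ a i / A) (z : ℝ) (k : ℕ) :
    HasSum (foxWrightTerm (fun i => a i + k * A) (fun _ => A) (fun j => b j + k * A) (fun _ => A)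
        (z : ℂ))
      ((A : ℂ)⁻¹ * ∫ ξ in Ioo (0 : ℝ) 1, cexp (z * ξ) *
        ((ξ : ℂ) ^ k * ((ξ : ℂ)⁻¹ * meijerG L b (ξ ^ (1 / A))))) := by
  obtain ⟨hint, hmom⟩ := integrableOn_and_moments L b hmu hA ha
  have hA' : (A : ℂ) ≠ 0 := by exact_mod_cast hA.ne'
  have hFk : IntegrableOn (fun ξ : ℝ => (ξ : ℂ) ^ k * ((ξ : ℂ)⁻¹ * meijerG L b (ξ ^ (1 / A))))
      (Ioo 0 1) := by
    refine hint.norm.mono' (AEStronglyMeasurable.mul (by fun_prop) hint.aestronglyMeasurable)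
      (ae_restrict_of_forall_mem measurableSet_Ioo fun ξ hξ => ?_)
    rw [norm_mul, norm_pow, norm_real, Real.norm_eq_abs, abs_of_pos hξ.1]
    exact mul_le_of_le_one_left (norm_nonneg _) (pow_le_one₀ hξ.1.le hξ.2.le)
  have h := hasSum_integral_mul_of_bound (ν := volume.restrict (Ioo 0 1)) hFk
    (f := fun n (ξ : ℝ) => ((z : ℂ) * ξ) ^ n / n.factorial) (g := fun ξ : ℝ => cexp (z * ξ))
    (Real.summable_pow_div_factorial |z|)
    (fun n => Measurable.aestronglyMeasurable (by fun_prop))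
    (fun n => ae_restrict_of_forall_mem measurableSet_Ioo fun ξ hξ => by
      rw [norm_div, norm_pow, norm_mul, norm_real, norm_real, Real.norm_eq_abs, Real.norm_eq_abs,
        abs_of_pos hξ.1, Complex.norm_natCast]
      refine div_le_div_of_nonneg_right (pow_le_pow_left₀
        (mul_nonneg (abs_nonneg _) hξ.1.le) ?_ n) (Nat.cast_nonneg _)
      exact mul_le_of_le_one_right (abs_nonneg _) hξ.2.le)
    (Eventually.of_forall fun ξ => by
      rw [Complex.exp_eq_exp_ℂ]
      exact NormedSpace.expSeries_div_hasSum_exp _)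
  refine HasSum.congr_fun (h.mul_left (A : ℂ)⁻¹) fun n => ?_
  symm
  have hmono : ∀ ξ : ℝ, ((z : ℂ) * ξ) ^ n / n.factorial
        * ((ξ : ℂ) ^ k * ((ξ : ℂ)⁻¹ * meijerG L b (ξ ^ (1 / A))))
      = (z : ℂ) ^ n / n.factorial
        * ((ξ : ℂ) ^ (k + n) * ((ξ : ℂ)⁻¹ * meijerG L b (ξ ^ (1 / A)))) := fun ξ => by
    rw [mul_pow, pow_add]
    ring
  simp only [hmono]
  rw [integral_const_mul, hmom, foxWrightTerm, gammaRatio_ofReal, mul_left_comm,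
    inv_mul_cancel_left₀ hA', mul_comm]
  simp only [Nat.cast_add, add_mul, add_assoc]

open MeasureTheory in
/-- Summation over `k` under the integral sign, by the binomial series in `t ξ`. -/
theorem hasSum_generating (lam : ℝ) (hlam : 0 < lam) (L : LeftLoop a) (b : Fin p → ℝ)
    (hmu : 0 < mu a b) {A : ℝ} (hA : 0 < A) (ha : ∀ i, 1 ≤ a i / A) {t : ℂ} (ht : ‖t‖ < 1)
    (z : ℝ) :
    IntervalIntegrable (fun ξ : ℝ => (ξ : ℂ)⁻¹ * (1 - t * (ξ : ℂ)) ^ (-(lam : ℂ))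
          * meijerG L b (ξ ^ (1 / A))) volume 0 1 ∧
      HasSum (fun k : ℕ => (gbinom (lam + k - 1) k : ℂ)
          * foxWright (fun i => a i + k * A) (fun _ => A) (fun j => b j + k * A) (fun _ => A)
            (z : ℂ) * t ^ k)
        (1 / (A : ℂ) * finiteLaplace 1 (fun ξ : ℝ => (ξ : ℂ)⁻¹ * (1 - t * (ξ : ℂ)) ^ (-(lam : ℂ))
            * meijerG L b (ξ ^ (1 / A))) (-z)) := by
  obtain ⟨hint, hmom⟩ := integrableOn_and_moments L b hmu hA ha
  have hslit : ∀ ξ ∈ Icc (0 : ℝ) 1, ‖t * (ξ : ℂ)‖ < 1 := fun ξ hξ => by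
    rw [norm_mul, norm_real, Real.norm_eq_abs, abs_of_nonneg hξ.1]
    exact (mul_le_of_le_one_right (norm_nonneg _) hξ.2).trans_lt ht
  have hcont : ContinuousOn (fun ξ : ℝ => (1 - t * (ξ : ℂ)) ^ (-(lam : ℂ))) (Icc 0 1) := by
    refine ContinuousOn.cpow_const (by fun_prop) fun ξ hξ => Or.inl ?_
    have h1 := (Complex.re_le_norm (t * ξ)).trans_lt (hslit ξ hξ)
    rw [sub_re, one_re]
    linarith
  have hintc := (integrableOn_Icc_iff_integrableOn_Ioo).mpr hint
  constructor
  · rw [intervalIntegrable_iff_integrableOn_Icc_of_le zero_le_one]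
    refine (hintc.continuousOn_mul hcont isCompact_Icc).congr_fun (fun ξ _ => ?_) measurableSet_Icc
    ring
  · have hFe : IntegrableOn (fun ξ : ℝ => cexp (z * ξ)
        * ((ξ : ℂ)⁻¹ * meijerG L b (ξ ^ (1 / A)))) (Ioo 0 1) :=
      (integrableOn_Icc_iff_integrableOn_Ioo).mp
        (hintc.continuousOn_mul (by fun_prop) isCompact_Icc)
    have h := hasSum_integral_mul_of_bound (ν := volume.restrict (Ioo 0 1)) hFe
      (f := fun k (ξ : ℝ) => (gbinom (lam + k - 1) k : ℂ) * (t * ξ) ^ k)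
      (g := fun ξ : ℝ => (1 - t * (ξ : ℂ)) ^ (-(lam : ℂ)))
      (summable_gbinom_mul_pow hlam (norm_nonneg t) ht)
      (fun n => Measurable.aestronglyMeasurable (by fun_prop))
      (fun k => ae_restrict_of_forall_mem measurableSet_Ioo fun ξ hξ => by
        rw [norm_mul, norm_real, Real.norm_eq_abs, abs_of_nonneg (gbinom_nonneg hlam k), norm_pow,
          norm_mul, norm_real, Real.norm_eq_abs, abs_of_pos hξ.1]
        refine mul_le_mul_of_nonneg_left ?_ (gbinom_nonneg hlam k)
        refine pow_le_pow_left₀ (mul_nonneg (norm_nonneg _) hξ.1.le) ?_ k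
        exact mul_le_of_le_one_right (norm_nonneg _) hξ.2.le)
      (ae_restrict_of_forall_mem measurableSet_Ioo fun ξ hξ =>
        hasSum_gbinom hlam (hslit ξ (Ioo_subset_Icc_self hξ)))
    have hL : 1 / (A : ℂ) * finiteLaplace 1 (fun ξ : ℝ => (ξ : ℂ)⁻¹
          * (1 - t * (ξ : ℂ)) ^ (-(lam : ℂ)) * meijerG L b (ξ ^ (1 / A))) (-z)
        = (A : ℂ)⁻¹ * ∫ ξ in Ioo (0 : ℝ) 1, (1 - t * (ξ : ℂ)) ^ (-(lam : ℂ))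
          * (cexp (z * ξ) * ((ξ : ℂ)⁻¹ * meijerG L b (ξ ^ (1 / A)))) := by
      rw [one_div, finiteLaplace, intervalIntegral.integral_of_le zero_le_one,
        integral_Ioc_eq_integral_Ioo]
      congr 2
      funext ξ
      rw [show -ξ * -z = z * ξ by ring]
      push_cast
      ring
    rw [hL]
    refine HasSum.congr_fun (h.mul_left (A : ℂ)⁻¹) fun k => ?_
    symm
    rw [foxWright, (hasSum_foxWrightTerm L b hmu hA ha z k).tsum_eq]
    have hmono : ∀ ξ : ℝ, (gbinom (lam + k - 1) k : ℂ) * (t * ξ) ^ k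
          * (cexp (z * ξ) * ((ξ : ℂ)⁻¹ * meijerG L b (ξ ^ (1 / A))))
        = (gbinom (lam + k - 1) k : ℂ) * t ^ k
          * (cexp (z * ξ) * ((ξ : ℂ) ^ k * ((ξ : ℂ)⁻¹ * meijerG L b (ξ ^ (1 / A))))) := fun ξ => by
      rw [mul_pow]
      ring
    simp only [hmono]
    rw [integral_const_mul]
    ring

end Generating

/-- As no `b j` is a pole, `Γ(x + n) = (x)_n Γ(x)` turns the hypergeometric series into a
Fox-Wright series. -/
lemma prod_Gamma_mul_hypergeometricTerm {p : ℕ} {a b : Fin p → ℝ} (ha : ∀ i, 1 ≤ a i)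
    (hb : ∀ j, ∀ n : ℕ, b j ≠ -(n : ℝ)) (z : ℂ) (k n : ℕ) :
    (((∏ i, Real.Gamma (a i + k)) / (∏ j, Real.Gamma (b j + k)) : ℝ) : ℂ)
        * hypergeometricTerm (fun i => a i + k) (fun j => b j + k) z n
      = foxWrightTerm (fun i => a i + k * (1 : ℝ)) (fun _ => 1) (fun j => b j + k * (1 : ℝ))
          (fun _ => 1) z n := by
  have hk : (0 : ℝ) ≤ k := k.cast_nonneg
  have h1 : ∀ i, Real.Gamma (a i + k + n)
      = (ascPochhammer ℝ n).eval (a i + k) * Real.Gamma (a i + k) := fun i =>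
    Gamma_add_natCast_eq _ (fun m h => by
      have : (0 : ℝ) ≤ m := m.cast_nonneg
      linarith [ha i]) n
  have h2 : ∀ j, Real.Gamma (b j + k + n)
      = (ascPochhammer ℝ n).eval (b j + k) * Real.Gamma (b j + k) := fun j =>
    Gamma_add_natCast_eq _ (fun m h => hb j (m + k) (by push_cast; linarith)) n
  simp only [hypergeometricTerm, foxWrightTerm, mul_one, h1, h2, Finset.prod_mul_distrib]
  rw [← mul_assoc, ← ofReal_mul, div_mul_div_comm, mul_comm (∏ i, Real.Gamma (a i + k)),
    mul_comm (∏ j, Real.Gamma (b j + k))]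

end FoxWright

theorem mainTheorem10 (lam : ℝ) (hlam : 0 < lam) (p q : ℕ) (hpq : p = q)
    (a : Fin p → ℝ) (b : Fin q → ℝ) (hmu : 0 < FoxWright.mu a b)
    (L : FoxWright.LeftLoop a) (t : ℂ) (ht : ‖t‖ < 1) (z : ℝ) :
    -- the case `A_i = B_j = A`
    (∀ A : ℝ, 0 < A → (∀ i, 1 ≤ a i / A) →
      (∀ k : ℕ, Summable (FoxWright.foxWrightTerm
        (fun i => a i + k * A) (fun _ => A) (fun j => b j + k * A) (fun _ => A) (z : ℂ))) ∧
      (∀ ξ ∈ Set.Ioo (0 : ℝ) (FoxWright.rho (fun _ : Fin p => A) (fun _ : Fin q => A)),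
        L.Converges (FoxWright.meijerGIntegrand a b (ξ ^ (1 / A)))) ∧
      IntervalIntegrable
        (fun ξ : ℝ => (ξ : ℂ)⁻¹ * (1 - t * (ξ : ℂ)) ^ (-(lam : ℂ))
          * FoxWright.meijerG L b (ξ ^ (1 / A)))
        MeasureTheory.volume 0 (FoxWright.rho (fun _ : Fin p => A) (fun _ : Fin q => A)) ∧
      HasSum
        (fun k : ℕ => (FoxWright.gbinom (lam + k - 1) k : ℂ)
          * FoxWright.foxWright
              (fun i => a i + k * A) (fun _ => A) (fun j => b j + k * A) (fun _ => A) (z : ℂ)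
          * t ^ k)
        (1 / (A : ℂ) * FoxWright.finiteLaplace
          (FoxWright.rho (fun _ : Fin p => A) (fun _ : Fin q => A))
          (fun ξ : ℝ => (ξ : ℂ)⁻¹ * (1 - t * (ξ : ℂ)) ^ (-(lam : ℂ))
            * FoxWright.meijerG L b (ξ ^ (1 / A)))
          (-z))) ∧
    -- the case `A = 1`, in terms of the generalized hypergeometric function
    ((∀ i, 1 ≤ a i) → (∀ j, ∀ n : ℕ, b j ≠ -(n : ℝ)) →
      (∀ k : ℕ, Summable (FoxWright.hypergeometricTerm
        (fun i => a i + k) (fun j => b j + k) (z : ℂ))) ∧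
      (∀ ξ ∈ Set.Ioo (0 : ℝ) (FoxWright.rho (fun _ : Fin p => 1) (fun _ : Fin q => 1)),
        L.Converges (FoxWright.meijerGIntegrand a b ξ)) ∧
      IntervalIntegrable
        (fun ξ : ℝ => (ξ : ℂ)⁻¹ * (1 - t * (ξ : ℂ)) ^ (-(lam : ℂ)) * FoxWright.meijerG L b ξ)
        MeasureTheory.volume 0 (FoxWright.rho (fun _ : Fin p => 1) (fun _ : Fin q => 1)) ∧
      HasSum
        (fun k : ℕ => (FoxWright.gbinom (lam + k - 1) k : ℂ)
          * (((∏ i, Real.Gamma (a i + k)) / (∏ j, Real.Gamma (b j + k)) : ℝ) : ℂ)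
          * FoxWright.hypergeometric (fun i => a i + k) (fun j => b j + k) (z : ℂ)
          * t ^ k)
        (FoxWright.finiteLaplace
          (FoxWright.rho (fun _ : Fin p => 1) (fun _ : Fin q => 1))
          (fun ξ : ℝ => (ξ : ℂ)⁻¹ * (1 - t * (ξ : ℂ)) ^ (-(lam : ℂ)) * FoxWright.meijerG L b ξ)
          (-z))) := by
  subst hpq
  refine ⟨fun A hA ha => ?_, fun ha hb => ?_⟩
  · rw [FoxWright.rho_const p hA]
    obtain ⟨h1, h2⟩ := FoxWright.hasSum_generating lam hlam L b hmu hA ha ht z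
    exact ⟨fun k => (FoxWright.hasSum_foxWrightTerm L b hmu hA ha z k).summable,
      fun ξ hξ => L.converges b hmu ⟨Real.rpow_pos_of_pos hξ.1 _,
        Real.rpow_lt_one hξ.1.le hξ.2 (one_div_pos.mpr hA)⟩, h1, h2⟩
  · have ha' : ∀ i, 1 ≤ a i / 1 := fun i => by rw [div_one]; exact ha i
    rw [FoxWright.rho_const p one_pos]
    obtain ⟨h1, h2⟩ := FoxWright.hasSum_generating lam hlam L b hmu one_pos ha' ht z
    simp only [div_one, Real.rpow_one, Complex.ofReal_one, one_mul] at h1 h2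
    have hterm := FoxWright.prod_Gamma_mul_hypergeometricTerm ha hb (z : ℂ)
    refine ⟨fun k => ?_, fun ξ hξ => L.converges b hmu hξ, h1, ?_⟩
    · have hk : (0 : ℝ) ≤ k := k.cast_nonneg
      have hne : (((∏ i, Real.Gamma (a i + k)) / (∏ j, Real.Gamma (b j + k)) : ℝ) : ℂ) ≠ 0 := by
        refine Complex.ofReal_ne_zero.mpr (div_ne_zero
          (Finset.prod_ne_zero_iff.mpr fun i _ => ?_) (Finset.prod_ne_zero_iff.mpr fun j _ => ?_))
        · exact (Real.Gamma_pos_of_pos (by linarith [ha i])).ne'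
        · exact Real.Gamma_ne_zero fun m h => hb j (m + k) (by push_cast; linarith)
      rw [← summable_mul_left_iff hne]
      simp only [hterm]
      exact (FoxWright.hasSum_foxWrightTerm L b hmu one_pos ha' z k).summable
    · refine HasSum.congr_fun h2 fun k => ?_
      rw [mul_assoc (FoxWright.gbinom (lam + k - 1) k : ℂ), FoxWright.hypergeometric,
        ← tsum_mul_left]
      simp only [hterm]
      rfl
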